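/- **Setting.** $|\cdot|$ is the Euclidean norm of vectors and the induced matrix norm, $|\cdot|_{\mathrm F}$ the Frobenius norm, and $|\xi|_{\mathcal A}=\inf_{y\in\mathcal A}|\xi-y|$. A hybrid time domain is a nonempty set $E\subset\mathbb R_{\ge0}\times\mathbb N$ such that for every $(T,J)\in E$ there are $0=t_0\le t_1\le\dots\le t_{J+1}$ with $E\cap([0,T]\times\{0,\dots,J\})=\bigcup_{j=0}^J[t_j,t_{j+1}]\times\{j\}$; $\Upsilon(E)=\{(t,j)\in E:(t,j+1)\in E\}$. For a signal $f$ on $E$, $\|f\|_{(t,j)}\in[0,\infty]$ is the maximum of $\operatorname{ess\,sup}|f(s,k)|$ over $(s,k)\in E\setminus\Upsilon(E)$ and $\sup|f(s,k)|$ over $(s,k)\in\Upsilon(E)$, both over $s\le t$, $k\le j$. A solution of a hybrid system $\dot\xi=F(\xi)$ ($\xi\in C$), $\xi^+=G(\xi)$ ($\xi\in D$) is a function $\xi$ on a hybrid time domain $\operatorname{dom}\xi$, with values in the state set, that is locally absolutely continuous in $t$ for each $j$, starts in $\overline C\cup D$, lies in $C$ in the interior of each interval of flow and satisfies $\dot\xi=F(\xi)$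 there almost everywhere, and satisfies $\xi(t,j)\in D$, $\xi(t,j+1)=G(\xi(t,j))$ for $(t,j)\in\Upsilon(\operatorname{dom}\xi)$. Solutions need not be maximal. Let $E$ be a hybrid time domain, $\phi_c,\phi_d:E\to\mathbb R^{n\times p}$, $u:E\to\mathbb R^m$, $\nu:E\to\mathbb R^n$, $\theta\in\mathbb R^p$, let $f_c,g_d:\mathbb R^n\times\mathbb R^m\to\mathbb R^n$ be continuous, and let $\gamma_c,\lambda_c,\gamma_d>0$, $\lambda_d\in(0,2)$. The system $\mathcal H_\nu$ has the state $\xi=(x,\hat\theta,\psi,\eta,\tau,k)\in\mathcal X_g=\mathbb R^n\times\mathbb R^p\times\mathbb R^{n\times p}\times\mathbb R^n\times E$, jump set $D=\{\xi\in\mathcal X_g:(\tau,k+1)\in E\}$, flow set $C=\overline{\mathcal X_g\setminus D}$, flows (with $\phi_c,u,\nu$ evaluated at $(\tau,k)$) $$\dot x=f_c(x,u)+\phi_c\theta,\quad \dot{\hat\theta}=\gamma_c\psi^\top(x+\nu+\eta-\psi\hat\theta),\quad \dot\psi=-\lambda_c\psi+\phi_c,\quad \dot\eta=-\lambda_c(x+\nu+\eta)-f_c(x+\nu,u),\quad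 \dot\tau=1,\ \dot k=0,$$ and jumps (with $\phi_d,u,\nu$ evaluated at $(\tau,k)$) $$x^+=g_d(x,u)+\phi_d\theta,\quad \psi^+=(1-\lambda_d)\psi+\phi_d,\quad \eta^+=(1-\lambda_d)(x+\nu+\eta)-g_d(x+\nu,u),$$ $$\hat\theta^+=\hat\theta+\frac{\psi^{+\top}}{\gamma_d+|\psi^+|^2}\big(x^++\nu(\tau,k+1)+\eta^+-\psi^+\hat\theta\big),\quad \tau^+=\tau,\ k^+=k+1.$$ Put $\varepsilon=x+\eta-\psi\theta$ and $\mathcal A_g=\{\xi\in\mathcal X_g:\hat\theta=\theta,\ \varepsilon=0\}$. **Assumptions.** (a) There are $L_c,L_d>0$ with $|f_c(x_1,u)-f_c(x_2,u)|\le L_c|x_1-x_2|$ and $|g_d(x_1,u)-g_d(x_2,u)|\le L_d|x_1-x_2|$ for all $x_1,x_2,u$. (b) There is $\phi_M>0$ with $|\phi_c|_{\mathrm F}\le\phi_M$ on $E$ and $|\phi_d|_{\mathrm F}\le\phi_M$ on $\Upsilon(E)$. Let $\psi_0\ge0$, $\Delta,\mu>0$, $q_M\ge q_m>0$, $\zeta\in(0,1)$,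 and let $\xi$ be a solution of $\mathcal H_\nu$ with $\xi(0,0)\in\mathcal X_g$ and $|\psi(0,0)|_{\mathrm F}\le\psi_0$ such that (c) for all $(t',j'),(t^*,j^*)\in\operatorname{dom}\xi$ with $\Delta\le(t^*-t')+(j^*-j')<\Delta+1$, $$\sum_{j=j'}^{j^*}\int_{\max\{t',t_j\}}^{\min\{t^*,t_{j+1}\}}\psi(s,j)^\top\psi(s,j)\,ds+\sum_{j=j'}^{j^*-1}\psi(t_{j+1},j+1)^\top\psi(t_{j+1},j+1)\ \ge\ \mu I,$$ where $[t_j,t_{j+1}]$ are the intervals of flow of $\operatorname{dom}\xi$. If (c) is void, i.e. $p=0$ or there are no such $(t',j'),(t^*,j^*)$, assume also that $\mu$ is so small that $\sigma<1$ below (otherwise $\sigma<1$ holds automatically). **Constants.** $$\psi_M=\psi_0+\max\Big\{\tfrac1{\lambda_c},\tfrac{\sqrt{2\lambda_d(2-\lambda_d)+16}}{\lambda_d(2-\lambda_d)}\Big\}\phi_M,\quad a_M=\gamma_c\psi_M^2,\quad \mu_0=\min\Big\{\gamma_c,\tfrac1{2(\gamma_d+\psi_M^2)}\Big\}\mu,$$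 $$\sigma=\frac{2\mu_0}{\big(1+\sqrt{(a_M+2)(\Delta+2)^3(a_M(\Delta+2)+1/2)}\big)^2},\quad \kappa_0=\sqrt{\tfrac1{1-\sigma}},\quad \lambda_0=-\frac{\ln(1-\sigma)}{2(\Delta+1)},$$ $$p_m=q_m,\quad p_M=q_m+\frac{q_M\kappa_0^2}{2\lambda_0}+\frac{q_M\kappa_0^2e^{2\lambda_0}}{e^{2\lambda_0}-1},\quad \rho=\sqrt{\frac{2p_M^2}{q_mp_m\zeta}\Big(\frac{2p_M}{q_m}+1\Big)},$$ $$\omega=\tfrac12\min\Big\{\tfrac{q_m}{2p_M}(1-\zeta),-\ln\big(1-\tfrac{q_m}{2p_M}(1-\zeta)\big)\Big\},\quad \lambda_\varepsilon=\tfrac12\min\Big\{\lambda_c(1-\zeta),-\ln\big(1-\tfrac{\lambda_d}2(2-\lambda_d)(1-\zeta)\big)\Big\},$$ $$\rho_\varepsilon=\max\Big\{\tfrac2{\lambda_c\sqrt\zeta},\tfrac{\sqrt{2\lambda_d(2-\lambda_d)+16}}{\lambda_d(2-\lambda_d)\sqrt\zeta}\Big\},\quad \kappa_\nu=\sqrt{\tfrac{2p_M}{p_m}},\quad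 \lambda_\nu=\min\{\omega,\lambda_\varepsilon\},\quad \rho_\nu=\sqrt2\max\{\rho,\rho_\varepsilon\}.$$ **Disturbances.** Along $\xi$ write $\nu(t,j)$, $u(t,j)$ for the values of $\nu,u$ at $(\tau(t,j),k(t,j))$, which is $(t,j)$ if $\tau,k$ start from $0$. For $(t,j)\in\operatorname{dom}\xi$ let $$d_c=-\gamma_c\psi^\top(\varepsilon+\nu),\qquad \alpha_c=-\lambda_c\nu+f_c(x,u)-f_c(x+\nu,u)$$ at $(t,j)$, and for $(t,j)\in\Upsilon(\operatorname{dom}\xi)$ let $$d_d(t,j)=-\frac{\psi(t,j+1)^\top}{\gamma_d+|\psi(t,j+1)|^2}\big(\varepsilon(t,j+1)+\nu(t,j+1)\big),\qquad \alpha_d(t,j)=\big[(1-\lambda_d)\nu+g_d(x,u)-g_d(x+\nu,u)\big](t,j).$$ Let $d=d_d$, $d_\varepsilon=\alpha_d$ on $\Upsilon(\operatorname{dom}\xi)$, $d=d_c$, $d_\varepsilon=\alpha_c$ on the rest of $\operatorname{dom}\xi$, and $d_\nu(t,j)=\sqrt{\|d\|_{(t,j)}^2+\|d_\varepsilon\|_{(t,j)}^2}\in[0,\infty]$.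 **Conclusion.** $\kappa_\nu,\lambda_\nu,\rho_\nu>0$, and for all $(t,j)\in\operatorname{dom}\xi$ $$|\xi(t,j)|_{\mathcal A_g}\le\kappa_\nu e^{-\lambda_\nu(t+j)}|\xi(0,0)|_{\mathcal A_g}+\rho_\nu d_\nu(t,j).$$ Moreover, with $\ell=\max\{\lambda_c+L_c,\ |1-\lambda_d|+L_d\}$, for all $(t,j)\in\operatorname{dom}\xi$ $$|d_c(t,j)|\le\gamma_c\psi_M\big(e^{-\lambda_\varepsilon(t+j)}|\varepsilon(0,0)|+\rho_\varepsilon\,\ell\,\|\nu\|_{(t,j)}+|\nu(t,j)|\big),\qquad |\alpha_c(t,j)|\le(\lambda_c+L_c)|\nu(t,j)|,$$ and for all $(t,j)\in\Upsilon(\operatorname{dom}\xi)$ $$|d_d(t,j)|\le\tfrac1{2\sqrt{\gamma_d}}\big(e^{-\lambda_\varepsilon(t+j+1)}|\varepsilon(0,0)|+\rho_\varepsilon\,\ell\,\|\nu\|_{(t,j+1)}+|\nu(t,j+1)|\big),\qquad |\alpha_d(t,j)|\le(|1-\lambda_d|+L_d)|\nu(t,j)|.$$ -/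

import Mathlib

open MeasureTheory Set
open scoped ENNReal Matrix

noncomputable section

/-! ### Hybrid time domains, hybrid arcs and solutions of hybrid systems -/

/-- `E ⊆ ℝ≥0 × ℕ` is a (nonempty) hybrid time domain: every truncation
`E ∩ ([0,T] × {0,…,J})` with `(T,J) ∈ E` is a finite union `⋃_{j ≤ J} [t_j, t_{j+1}] × {j}` with
`0 = t_0 ≤ t_1 ≤ ⋯ ≤ t_{J+1}`. -/
def IsHybridTimeDomain (E : Set (ℝ × ℕ)) : Prop :=
  E.Nonempty ∧ (∀ q ∈ E, 0 ≤ q.1) ∧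
    ∀ T : ℝ, ∀ J : ℕ, (T, J) ∈ E → ∃ t : ℕ → ℝ, Monotone t ∧ t 0 = 0 ∧
      E ∩ (Icc 0 T ×ˢ Iic J) = {q | q.2 ≤ J ∧ q.1 ∈ Icc (t q.2) (t (q.2 + 1))}

/-- The slice `I^j = {t : (t,j) ∈ E}`. -/
def timeSlice (E : Set (ℝ × ℕ)) (j : ℕ) : Set ℝ := {t | (t, j) ∈ E}

/-- `Υ(E) = {(t,j) ∈ E : (t,j+1) ∈ E}`, the points of `E` from which a jump takes place. -/
def jumpPoints (E : Set (ℝ × ℕ)) : Set (ℝ × ℕ) := {q | q ∈ E ∧ (q.1, q.2 + 1) ∈ E}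

/-- The left end `t_j` of the slice `I^j`; for `j ≥ 1` it is the time of the `j`-th jump. -/
def jumpTime (E : Set (ℝ × ℕ)) (j : ℕ) : ℝ := sInf (timeSlice E j)

/-- The supremum norm `‖f‖_{(t,j)}` of a hybrid signal `f` on `E`: the maximum of the essential
supremum of `|f(s,k)|` over `(s,k) ∈ E ∖ Υ(E)`, `(s,k) ≤ (t,j)`, and of the supremum of `|f(s,k)|`
over `(s,k) ∈ Υ(E)`, `(s,k) ≤ (t,j)`. It is `∞` if the signal is unbounded. -/
def hybridSupNorm {V : Type*} [NormedAddCommGroup V] (E : Set (ℝ × ℕ)) (f : ℝ → ℕ → V)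
    (t : ℝ) (j : ℕ) : ℝ≥0∞ :=
  max
    (⨆ k ∈ Iic j, essSup (fun s => ‖f s k‖ₑ)
      (volume.restrict {s | (s, k) ∈ E \ jumpPoints E ∧ s ≤ t}))
    (⨆ q ∈ {q : ℝ × ℕ | q ∈ jumpPoints E ∧ q.1 ≤ t ∧ q.2 ≤ j}, ‖f q.1 q.2‖ₑ)

/-- A hybrid system with state in `stateSet`: `ξ' = F ξ` on `C`, `ξ⁺ = G ξ` on `D`. -/
structure HybridSystem (X : Type*) where
  stateSet : Set X
  C : Set X
  F : X → X
  D : Set X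
  G : X → X

/-- `ξ` with `dom ξ = S` is a solution of the hybrid system `H`: a hybrid arc (locally absolutely
continuous on every slice of a hybrid time domain) with values in the state set that flows in `C`
according to `F` (almost everywhere) and jumps from `D` according to `G`. The values of `ξ` outside
`S` are irrelevant. Solutions need be neither maximal nor complete. -/
structure HybridSystem.IsSolution {X : Type*} [NormedAddCommGroup X] [NormedSpace ℝ X]
    (H : HybridSystem X) (S : Set (ℝ × ℕ)) (ξ : ℝ → ℕ → X) : Prop where
  dom : IsHybridTimeDomain S
  mem_state : ∀ t j, (t, j) ∈ S → ξ t j ∈ H.stateSet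
  abs_cont : ∀ j a b, a ≤ b → Icc a b ⊆ timeSlice S j →
    AbsolutelyContinuousOnInterval (fun s => ξ s j) a b
  initial : ξ 0 0 ∈ closure H.C ∪ H.D
  flow_mem : ∀ j, ∀ t ∈ interior (timeSlice S j), ξ t j ∈ H.C
  flow : ∀ j, ∀ᵐ t : ℝ, t ∈ interior (timeSlice S j) →
    HasDerivAt (fun s => ξ s j) (H.F (ξ t j)) t
  jump_mem : ∀ t j, (t, j) ∈ jumpPoints S → ξ t j ∈ H.D
  jump : ∀ t j, (t, j) ∈ jumpPoints S → ξ t (j + 1) = H.G (ξ t j)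

/-! ### Matrices -/

open scoped Matrix.Norms.L2Operator in
/-- The matrix norm induced by the Euclidean vector norms. -/
def specNorm {n p : ℕ} (M : Matrix (Fin n) (Fin p) ℝ) : ℝ := ‖M‖

open scoped Matrix.Norms.Frobenius in
/-- The Frobenius norm. -/
def frobNorm {n p : ℕ} (M : Matrix (Fin n) (Fin p) ℝ) : ℝ := ‖M‖

/-- The product of a matrix and a Euclidean vector. -/
def mulE {n p : ℕ} (M : Matrix (Fin n) (Fin p) ℝ) (v : EuclideanSpace ℝ (Fin p)) :
    EuclideanSpace ℝ (Fin n) := WithLp.toLp 2 (M *ᵥ v.ofLp)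

/-! ### The state space `ℝⁿ × ℝᵖ × ℝⁿˣᵖ × ℝⁿ × ℝ × ℝ` with its Euclidean norm -/

/-- The space of the states `ξ = (x, θ̂, ψ, η, τ, k)`. -/
abbrev EstState (n p : ℕ) : Type :=
  EuclideanSpace ℝ (Fin n ⊕ Fin p ⊕ (Fin n × Fin p) ⊕ Fin n ⊕ Unit ⊕ Unit)

namespace EstState

variable {n p : ℕ}

/-- The state with the given components. -/
def mk (x : EuclideanSpace ℝ (Fin n)) (th : EuclideanSpace ℝ (Fin p))
    (psi : Matrix (Fin n) (Fin p) ℝ) (eta : EuclideanSpace ℝ (Fin n)) (tau k : ℝ) :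
    EstState n p :=
  WithLp.toLp 2 (Sum.elim x.ofLp (Sum.elim th.ofLp (Sum.elim (fun q => psi q.1 q.2)
    (Sum.elim eta.ofLp (Sum.elim (fun _ => tau) (fun _ => k))))))

/-- The plant state `x`. -/
def x (ξ : EstState n p) : EuclideanSpace ℝ (Fin n) := WithLp.toLp 2 fun i => ξ (.inl i)

/-- The parameter estimate `θ̂`. -/
def th (ξ : EstState n p) : EuclideanSpace ℝ (Fin p) :=
  WithLp.toLp 2 fun a => ξ (.inr (.inl a))

/-- The auxiliary state `ψ`. -/
def psi (ξ : EstState n p) : Matrix (Fin n) (Fin p) ℝ :=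
  Matrix.of fun i a => ξ (.inr (.inr (.inl (i, a))))

/-- The auxiliary state `η`. -/
def eta (ξ : EstState n p) : EuclideanSpace ℝ (Fin n) :=
  WithLp.toLp 2 fun i => ξ (.inr (.inr (.inr (.inl i))))

/-- The ordinary time `τ`. -/
def tau (ξ : EstState n p) : ℝ := ξ (.inr (.inr (.inr (.inr (.inl ())))))

/-- The jump counter `k` as a real coordinate. -/
def kReal (ξ : EstState n p) : ℝ := ξ (.inr (.inr (.inr (.inr (.inr ())))))

/-- The jump counter `k` as a natural number; on the state set of the estimator the coordinate
`kReal` is a natural number and the floor changes nothing. -/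
def k (ξ : EstState n p) : ℕ := ⌊ξ.kReal⌋₊

end EstState

/-! ### The data, the constants, and the estimator under measurement noise -/

/-- The data of the estimation problem: the hybrid time domain `E`, the regressors, the input and
the measurement noise (signals on `E`; their values outside `E` are irrelevant), the plant maps
`f_c`, `g_d` and the parameter `θ`. -/
structure EstData (n p m : ℕ) where
  E : Set (ℝ × ℕ)
  phic : ℝ → ℕ → Matrix (Fin n) (Fin p) ℝ
  phid : ℝ → ℕ → Matrix (Fin n) (Fin p) ℝ
  u : ℝ → ℕ → EuclideanSpace ℝ (Fin m)
  nu : ℝ → ℕ → EuclideanSpace ℝ (Fin n)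
  fc : EuclideanSpace ℝ (Fin n) → EuclideanSpace ℝ (Fin m) → EuclideanSpace ℝ (Fin n)
  gd : EuclideanSpace ℝ (Fin n) → EuclideanSpace ℝ (Fin m) → EuclideanSpace ℝ (Fin n)
  theta : EuclideanSpace ℝ (Fin p)

/-- The real parameters: the gains `γ_c, λ_c, γ_d, λ_d`, the bounds `φ_M` on the regressors and
`ψ_0` on the initial value of `ψ`, the excitation parameters `Δ, μ`, and the free parameters
`q_m, q_M, ζ`. -/
structure EstParams where
  gamc : ℝ
  lamc : ℝ
  gamd : ℝ
  lamd : ℝ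
  phiM : ℝ
  psi0 : ℝ
  Delta : ℝ
  mu : ℝ
  qm : ℝ
  qM : ℝ
  zeta : ℝ

namespace EstParams

variable (P : EstParams)

/-- The admissible values of the parameters. -/
structure Admissible : Prop where
  gamc_pos : 0 < P.gamc
  lamc_pos : 0 < P.lamc
  gamd_pos : 0 < P.gamd
  lamd_mem : P.lamd ∈ Ioo (0 : ℝ) 2
  phiM_pos : 0 < P.phiM
  psi0_nonneg : 0 ≤ P.psi0
  Delta_pos : 0 < P.Delta
  mu_pos : 0 < P.mu
  qm_pos : 0 < P.qm
  qm_le_qM : P.qm ≤ P.qM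
  zeta_mem : P.zeta ∈ Ioo (0 : ℝ) 1

/-- `ψ_M`. -/
def psiM : ℝ :=
  P.psi0 + max (1 / P.lamc)
    (√(2 * P.lamd * (2 - P.lamd) + 16) / (P.lamd * (2 - P.lamd))) * P.phiM

/-- `a_M`. -/
def aM : ℝ := P.gamc * P.psiM ^ 2

/-- `μ_0`. -/
def mu0 : ℝ := min P.gamc (1 / (2 * (P.gamd + P.psiM ^ 2))) * P.mu

/-- `σ`. -/
def sigma : ℝ :=
  2 * P.mu0 /
    (1 + √((P.aM + 2) * (P.Delta + 2) ^ 3 * (P.aM * (P.Delta + 2) + 1 / 2))) ^ 2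

/-- `κ_0`. -/
def kappa0 : ℝ := √(1 / (1 - P.sigma))

/-- `λ_0`. -/
def lam0 : ℝ := -Real.log (1 - P.sigma) / (2 * (P.Delta + 1))

/-- `p_m`. -/
def pm : ℝ := P.qm

/-- `p_M`. -/
def pM : ℝ :=
  P.qm + P.qM * P.kappa0 ^ 2 / (2 * P.lam0)
    + P.qM * P.kappa0 ^ 2 * Real.exp (2 * P.lam0) / (Real.exp (2 * P.lam0) - 1)

/-- `ω`. -/
def omega : ℝ :=
  1 / 2 * min (P.qm / (2 * P.pM) * (1 - P.zeta))
    (-Real.log (1 - P.qm / (2 * P.pM) * (1 - P.zeta)))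

/-- `ρ`. -/
def rho : ℝ :=
  √(2 * P.pM ^ 2 / (P.qm * P.pm * P.zeta) * (2 * P.pM / P.qm + 1))

/-- `λ_ε`. -/
def lamEps : ℝ :=
  1 / 2 * min (P.lamc * (1 - P.zeta))
    (-Real.log (1 - P.lamd / 2 * (2 - P.lamd) * (1 - P.zeta)))

/-- `ρ_ε`. -/
def rhoEps : ℝ :=
  max (2 / (P.lamc * √P.zeta))
    (√(2 * P.lamd * (2 - P.lamd) + 16) / (P.lamd * (2 - P.lamd) * √P.zeta))

/-- `κ_ν`. -/
def kappaNu : ℝ := √(2 * P.pM / P.pm)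

/-- `λ_ν`. -/
def lamNu : ℝ := min P.omega P.lamEps

/-- `ρ_ν`. -/
def rhoNu : ℝ := √2 * max P.rho P.rhoEps

end EstParams

namespace EstData

variable {n p m : ℕ} (W : EstData n p m) (P : EstParams)

/-- The state set `𝒳_g = ℝⁿ × ℝᵖ × ℝⁿˣᵖ × ℝⁿ × E`. -/
def stateSet : Set (EstState n p) := {ξ | ξ.kReal = ξ.k ∧ (ξ.tau, ξ.k) ∈ W.E}

/-- The jump set `D_g`. -/
def jumpSet : Set (EstState n p) := {ξ | ξ ∈ W.stateSet ∧ (ξ.tau, ξ.k + 1) ∈ W.E}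

/-- The flow set `C_g`. -/
def flowSet : Set (EstState n p) := closure (W.stateSet \ W.jumpSet)

/-- The flow map `F_ν`. -/
def flowMap (ξ : EstState n p) : EstState n p :=
  let u := W.u ξ.tau ξ.k
  let nu := W.nu ξ.tau ξ.k
  let phi := W.phic ξ.tau ξ.k
  let y := ξ.x + nu + ξ.eta
  EstState.mk
    (W.fc ξ.x u + mulE phi W.theta)
    (P.gamc • mulE ξ.psiᵀ (y - mulE ξ.psi ξ.th))
    (-P.lamc • ξ.psi + phi)
    (-P.lamc • (ξ.x + nu + ξ.eta) - W.fc (ξ.x + nu) u)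
    1
    0

/-- The jump map `G_ν`. -/
def jumpMap (ξ : EstState n p) : EstState n p :=
  let u := W.u ξ.tau ξ.k
  let nu := W.nu ξ.tau ξ.k
  let phi := W.phid ξ.tau ξ.k
  let xPlus := W.gd ξ.x u + mulE phi W.theta
  let psiPlus := (1 - P.lamd) • ξ.psi + phi
  let etaPlus := (1 - P.lamd) • (ξ.x + nu + ξ.eta) - W.gd (ξ.x + nu) u
  let yPlus := xPlus + W.nu ξ.tau (ξ.k + 1) + etaPlus
  EstState.mk
    xPlus
    (ξ.th + (1 / (P.gamd + specNorm psiPlus ^ 2)) •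
      mulE psiPlusᵀ (yPlus - mulE psiPlus ξ.th))
    psiPlus
    etaPlus
    ξ.tau
    (ξ.kReal + 1)

/-- The estimator `ℋ_ν` under the measurement noise `ν`. -/
def noisySystem : HybridSystem (EstState n p) where
  stateSet := W.stateSet
  C := W.flowSet
  F := W.flowMap P
  D := W.jumpSet
  G := W.jumpMap P

/-- `ε = x + η - ψ θ`. -/
def eps (ξ : EstState n p) : EuclideanSpace ℝ (Fin n) := ξ.x + ξ.eta - mulE ξ.psi W.theta

/-- The target set `𝒜_g = {ξ ∈ 𝒳_g : θ̂ = θ, ε = 0}`. -/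
def target : Set (EstState n p) := {ξ | ξ ∈ W.stateSet ∧ ξ.th = W.theta ∧ W.eps ξ = 0}

/-- The set of initial states `𝒳_0 = {ξ ∈ 𝒳_g : |ψ|_F ≤ ψ_0}`. -/
def initialSet : Set (EstState n p) := {ξ | ξ ∈ W.stateSet ∧ frobNorm ξ.psi ≤ P.psi0}

/-! The signals below are taken along a solution `ξ` with domain `S`. A signal on `E` is read at
`(τ(t,j), k(t,j))`, which is `(t,j)` when `(τ,k)` starts from `(0,0)`. -/

variable (S : Set (ℝ × ℕ)) (ξ : ℝ → ℕ → EstState n p)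

/-- The noise along the solution. -/
def nuAt (t : ℝ) (j : ℕ) : EuclideanSpace ℝ (Fin n) := W.nu (ξ t j).tau (ξ t j).k

/-- The input along the solution. -/
def uAt (t : ℝ) (j : ℕ) : EuclideanSpace ℝ (Fin m) := W.u (ξ t j).tau (ξ t j).k

/-- `d_c`. -/
def dc (t : ℝ) (j : ℕ) : EuclideanSpace ℝ (Fin p) :=
  -(P.gamc • mulE (ξ t j).psiᵀ (W.eps (ξ t j) + W.nuAt ξ t j))

/-- `d_d`. -/
def dd (t : ℝ) (j : ℕ) : EuclideanSpace ℝ (Fin p) :=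
  -((1 / (P.gamd + specNorm (ξ t (j + 1)).psi ^ 2)) •
    mulE (ξ t (j + 1)).psiᵀ (W.eps (ξ t (j + 1)) + W.nuAt ξ t (j + 1)))

/-- `α_c`. -/
def alphac (t : ℝ) (j : ℕ) : EuclideanSpace ℝ (Fin n) :=
  -P.lamc • W.nuAt ξ t j + W.fc (ξ t j).x (W.uAt ξ t j)
    - W.fc ((ξ t j).x + W.nuAt ξ t j) (W.uAt ξ t j)

/-- `α_d`. -/
def alphad (t : ℝ) (j : ℕ) : EuclideanSpace ℝ (Fin n) :=
  (1 - P.lamd) • W.nuAt ξ t j + W.gd (ξ t j).x (W.uAt ξ t j)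
    - W.gd ((ξ t j).x + W.nuAt ξ t j) (W.uAt ξ t j)

open scoped Classical in
/-- `d`: equal to `d_d` at the jump points and to `d_c` elsewhere. -/
def dTot (t : ℝ) (j : ℕ) : EuclideanSpace ℝ (Fin p) :=
  if (t, j) ∈ jumpPoints S then W.dd P ξ t j else W.dc P ξ t j

open scoped Classical in
/-- `d_ε`: equal to `α_d` at the jump points and to `α_c` elsewhere. -/
def dEps (t : ℝ) (j : ℕ) : EuclideanSpace ℝ (Fin n) :=
  if (t, j) ∈ jumpPoints S then W.alphad P ξ t j else W.alphac P ξ t j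

/-- `d_ν(t,j) = (‖d‖²_{(t,j)} + ‖d_ε‖²_{(t,j)})^{1/2}`. -/
def dNu (t : ℝ) (j : ℕ) : ℝ≥0∞ :=
  (hybridSupNorm S (W.dTot P S ξ) t j ^ 2 + hybridSupNorm S (W.dEps P S ξ) t j ^ 2) ^ (1 / 2 : ℝ)

end EstData

/-! ### Hybrid persistence of excitation -/

/-- `a = (t',j')` and `b = (t*,j*)` satisfy `Δ ≤ (t* - t') + (j* - j') < Δ + 1`. -/
def IsWindow (Δ : ℝ) (a b : ℝ × ℕ) : Prop :=
  Δ ≤ (b.1 - a.1) + ((b.2 : ℝ) - (a.2 : ℝ)) ∧ (b.1 - a.1) + ((b.2 : ℝ) - (a.2 : ℝ)) < Δ + 1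

/-- The excitation matrix of `ψ` on `S` from `a = (t',j')` to `b = (t*,j*)`: the sum over
`j' ≤ j ≤ j*` of the (entrywise) integrals of `ψᵀψ(·,j)` over `I^j ∩ [t',t*]`, which is
`[max(t',t_j), min(t*,t_{j+1})]`, plus the sum over `j' ≤ j < j*` of `ψᵀψ(t_{j+1},j+1)`. -/
def excitation {n p : ℕ} (S : Set (ℝ × ℕ)) (ψ : ℝ → ℕ → Matrix (Fin n) (Fin p) ℝ)
    (a b : ℝ × ℕ) : Matrix (Fin p) (Fin p) ℝ :=
  (∑ j ∈ Finset.Icc a.2 b.2,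
      Matrix.of fun r c => ∫ s in timeSlice S j ∩ Icc a.1 b.1, ((ψ s j)ᵀ * ψ s j) r c)
    + ∑ j ∈ Finset.Ico a.2 b.2,
      (ψ (jumpTime S (j + 1)) (j + 1))ᵀ * ψ (jumpTime S (j + 1)) (j + 1)

/-- The hybrid persistence of excitation condition for `ψ` on `S` with parameters `Δ, μ`. -/
def HybridPE {n p : ℕ} (S : Set (ℝ × ℕ)) (ψ : ℝ → ℕ → Matrix (Fin n) (Fin p) ℝ)
    (Δ μ : ℝ) : Prop :=
  ∀ a ∈ S, ∀ b ∈ S, IsWindow Δ a b →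
    (excitation S ψ a b - μ • (1 : Matrix (Fin p) (Fin p) ℝ)).PosSemidef

end

/-! ### Structure of hybrid time domains -/

namespace IsHybridTimeDomain

variable {S : Set (ℝ × ℕ)}

theorem exists_times (hS : IsHybridTimeDomain S) {T : ℝ} {J : ℕ} (h : (T, J) ∈ S) :
    ∃ t : ℕ → ℝ, Monotone t ∧ t 0 = 0 ∧ t (J + 1) = T ∧
      ∀ s k, k ≤ J → ((s, k) ∈ S ∧ s ≤ T ↔ s ∈ Icc (t k) (t (k + 1))) := by
  obtain ⟨-, hpos, hS⟩ := hS
  obtain ⟨t, hm, h0, ht⟩ := hS T J h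
  have key : ∀ s k, k ≤ J → ((s, k) ∈ S ∧ s ≤ T ↔ s ∈ Icc (t k) (t (k + 1))) := by
    intro s k hk
    have := Set.ext_iff.1 ht (s, k)
    simp only [mem_inter_iff, mem_prod, mem_Icc, mem_Iic, mem_ofPred_eq] at this
    constructor
    · rintro ⟨h1, h2⟩
      exact (this.1 ⟨h1, ⟨hpos _ h1, h2⟩, hk⟩).2
    · intro h1
      have := this.2 ⟨hk, h1⟩
      exact ⟨this.1, this.2.1.2⟩
  refine ⟨t, hm, h0, le_antisymm ?_ ?_, key⟩
  · exact ((key _ J le_rfl).2 ⟨hm (Nat.le_succ J), le_rfl⟩).2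
  · exact ((key T J le_rfl).1 ⟨h, le_rfl⟩).2

theorem fst_nonneg (hS : IsHybridTimeDomain S) {s : ℝ} {k : ℕ} (h : (s, k) ∈ S) : 0 ≤ s :=
  hS.2.1 _ h

theorem zero_mem (hS : IsHybridTimeDomain S) : ((0 : ℝ), 0) ∈ S := by
  obtain ⟨⟨T, J⟩, h⟩ := hS.1
  obtain ⟨t, hm, h0, -, ht⟩ := hS.exists_times h
  exact ((ht 0 0 (Nat.zero_le _)).2 ⟨h0.le, h0 ▸ hm (Nat.zero_le _)⟩).1

theorem fst_le_of_lt (hS : IsHybridTimeDomain S) {b : ℝ × ℕ} (hb : b ∈ S) {s s' : ℝ} {k k' : ℕ}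
    (h : (s, k) ∈ S) (h' : (s', k') ∈ S) (hs : s ≤ b.1) (hs' : s' ≤ b.1) (hk' : k' ≤ b.2)
    (hk : k < k') : s ≤ s' := by
  obtain ⟨t, hm, -, -, ht⟩ := hS.exists_times hb
  exact ((ht s k (hk.le.trans hk')).1 ⟨h, hs⟩).2.trans
    ((hm hk).trans ((ht s' k' hk').1 ⟨h', hs'⟩).1)

theorem mem_of_mem_Icc (hS : IsHybridTimeDomain S) {s s' r : ℝ} {k : ℕ} (h : (s, k) ∈ S)
    (h' : (s', k) ∈ S) (hr : r ∈ Icc s s') : (r, k) ∈ S := by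
  obtain ⟨t, -, -, -, ht⟩ := hS.exists_times h'
  have h1 := (ht s k le_rfl).1 ⟨h, hr.1.trans hr.2⟩
  have h2 := (ht s' k le_rfl).1 ⟨h', le_rfl⟩
  exact ((ht r k le_rfl).2 ⟨h1.1.trans hr.1, hr.2.trans h2.2⟩).1

theorem jumpPoints_unique (hS : IsHybridTimeDomain S) {s s' : ℝ} {k : ℕ}
    (h : (s, k) ∈ jumpPoints S) (h' : (s', k) ∈ jumpPoints S) : s = s' := by
  wlog hle : s ≤ s' generalizing s s'
  · exact (this h' h (le_of_not_ge hle)).symm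
  exact le_antisymm hle
    (hS.fst_le_of_lt (b := (s', k + 1)) h'.2 h'.1 h.2 le_rfl hle le_rfl (Nat.lt_succ_self k))

theorem ae_notMem_jumpPoints (hS : IsHybridTimeDomain S) (k : ℕ) :
    ∀ᵐ s : ℝ, (s, k) ∉ jumpPoints S := by
  have hsub : {s : ℝ | (s, k) ∈ jumpPoints S}.Subsingleton :=
    fun _ h _ h' => hS.jumpPoints_unique h h'
  have := hsub.measure_zero volume
  rw [ae_iff]
  simpa using this

theorem jumpTime_eq (hS : IsHybridTimeDomain S) {s : ℝ} {k : ℕ} (h : (s, k) ∈ jumpPoints S) :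
    jumpTime S (k + 1) = s := by
  refine IsLeast.csInf_eq ⟨h.2, fun r hr => ?_⟩
  by_contra! hlt
  exact hlt.not_ge
    (hS.fst_le_of_lt (b := (s, k + 1)) h.2 h.1 hr le_rfl hlt.le le_rfl (Nat.lt_succ_self k))

theorem exists_slice_eq_Icc (hS : IsHybridTimeDomain S) {b : ℝ × ℕ} (hb : b ∈ S) {r : ℝ}
    {k : ℕ} (hk : k ≤ b.2) :
    ∃ c d, timeSlice S k ∩ Icc r b.1 = Icc c d := by
  obtain ⟨t, -, -, -, ht⟩ := hS.exists_times hb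
  refine ⟨max r (t k), t (k + 1), ?_⟩
  ext s
  have := ht s k hk
  simp only [timeSlice, mem_inter_iff, mem_ofPred_eq, mem_Icc, max_le_iff] at *
  tauto

/-- Induction along a hybrid time domain from `a` to `b`. -/
theorem induction (hS : IsHybridTimeDomain S) {a b : ℝ × ℕ} (ha : a ∈ S) (hb : b ∈ S)
    (hab : a ≤ b) {P : ℝ → ℕ → Prop} (base : P a.1 a.2)
    (flow : ∀ k s s', a.2 ≤ k → k ≤ b.2 → a.1 ≤ s → s ≤ s' → s' ≤ b.1 → (s, k) ∈ S →
      (s', k) ∈ S → P s k → P s' k)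
    (jump : ∀ k s, a.2 ≤ k → k < b.2 → a.1 ≤ s → s ≤ b.1 → (s, k) ∈ jumpPoints S →
      P s k → P s (k + 1)) : P b.1 b.2 := by
  obtain ⟨t, hm, -, hT, ht⟩ := hS.exists_times hb
  have ha' := (ht a.1 a.2 hab.2).1 ⟨ha, hab.1⟩
  have key : ∀ k, a.2 ≤ k → k ≤ b.2 → ∀ s, a.1 ≤ s → s ∈ Icc (t k) (t (k + 1)) → P s k := by
    intro k hk
    induction k, hk using Nat.le_induction with
    | base =>
      intro hk s has hs
      have h1 := (ht s _ hk).2 hs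
      exact flow _ _ _ le_rfl hk le_rfl has h1.2 ha h1.1 base
    | succ k hk ih =>
      intro hkb s has hs
      have e1 : t (k + 1) ∈ Icc (t k) (t (k + 1)) := ⟨hm (Nat.le_succ k), le_rfl⟩
      have e2 : t (k + 1) ∈ Icc (t (k + 1)) (t (k + 1 + 1)) := ⟨le_rfl, hm (Nat.le_succ _)⟩
      have hat : a.1 ≤ t (k + 1) := ha'.2.trans (hm (by omega))
      have m1 := (ht _ k (by omega)).2 e1
      have m2 := (ht _ (k + 1) hkb).2 e2
      have m3 := (ht _ (k + 1) hkb).2 hs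
      exact flow _ _ _ (by omega) hkb hat hs.1 m3.2 m2.1 m3.1
        (jump k _ hk (by omega) hat m1.2 ⟨m1.1, m2.1⟩
          (ih (by omega) _ hat e1))
  exact key b.2 hab.2 le_rfl b.1 hab.1 ((ht b.1 b.2 le_rfl).1 ⟨hb, le_rfl⟩)

/-- The hybrid time `t + j` reaches every level up to jumps of unit length. -/
theorem exists_mem_level (hS : IsHybridTimeDomain S) {b : ℝ × ℕ} (hb : b ∈ S) {c : ℝ}
    (hc : 0 ≤ c) (hcb : c ≤ b.1 + b.2) :
    ∃ a ∈ S, a ≤ b ∧ a.1 + a.2 ≤ c ∧ c < a.1 + a.2 + 1 := by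
  have h0 : ((0 : ℝ), 0) ≤ b := ⟨hS.fst_nonneg (k := b.2) hb, Nat.zero_le _⟩
  have := hS.induction hS.zero_mem hb h0
    (P := fun s k => c ≤ s + k → ∃ a ∈ S, a ≤ (s, k) ∧ a.1 + a.2 ≤ c ∧ c < a.1 + a.2 + 1)
    (fun h => ⟨(0, 0), hS.zero_mem, le_rfl, by simpa using hc, by simp at h ⊢; linarith⟩)
    (fun k s s' _ _ _ hss _ hs hs' ih hle => ?_) (fun k s _ _ _ _ hs ih hle => ?_)
  · exact this hcb
  · rcases le_total c (s + k) with h | h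
    · obtain ⟨a, ha, hab, h1⟩ := ih h
      exact ⟨a, ha, hab.trans ⟨hss, le_rfl⟩, h1⟩
    · refine ⟨(c - k, k), hS.mem_of_mem_Icc hs hs' ⟨by linarith, by linarith⟩,
        ⟨by simp; linarith, le_rfl⟩, by simp, by simp⟩
  · rcases le_total c (s + k) with h | h
    · obtain ⟨a, ha, hab, h1⟩ := ih h
      exact ⟨a, ha, hab.trans ⟨le_rfl, Nat.le_succ k⟩, h1⟩
    · push_cast at hle
      rcases lt_or_ge c (s + k + 1) with h' | h'
      · exact ⟨(s, k), hs.1, ⟨le_rfl, Nat.le_succ k⟩, h, h'⟩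
      · refine ⟨(s, k + 1), hs.2, le_rfl, ?_, ?_⟩ <;> push_cast <;> linarith

end IsHybridTimeDomain

/-! ### Absolutely continuous functions -/

namespace AbsolutelyContinuousOnInterval

variable {X Y : Type*} [PseudoMetricSpace X] [PseudoMetricSpace Y] {a b : ℝ}

theorem comp_lipschitz {f : ℝ → X} (hf : AbsolutelyContinuousOnInterval f a b) {L : X → Y}
    {K : NNReal} (hL : LipschitzWith K L) :
    AbsolutelyContinuousOnInterval (fun s => L (f s)) a b := by
  unfold AbsolutelyContinuousOnInterval at *
  refine squeeze_zero (fun t => Finset.sum_nonneg fun i _ => dist_nonneg) (fun t => ?_)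
    (by simpa using hf.const_mul (K : ℝ))
  rw [Finset.mul_sum]
  exact Finset.sum_le_sum fun i _ => hL.dist_le_mul _ _

theorem le_add_integral {v f : ℝ → ℝ} (hv : AbsolutelyContinuousOnInterval v a b) (hab : a ≤ b)
    (hf : IntegrableOn f (Icc a b)) (h : ∀ᵐ s, s ∈ Ioo a b → deriv v s ≤ f s) :
    v b ≤ v a + ∫ s in Icc a b, f s := by
  have h1 := hv.integral_deriv_eq_sub
  have hf' : IntervalIntegrable f volume a b :=
    (intervalIntegrable_iff_integrableOn_Icc_of_le hab).2 hf
  have h2 : ∫ s in a..b, deriv v s ≤ ∫ s in a..b, f s := by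
    refine intervalIntegral.integral_mono_ae_restrict hab hv.intervalIntegrable_deriv hf' ?_
    rw [Filter.EventuallyLE, ← restrict_Ioo_eq_restrict_Icc]
    exact (ae_restrict_iff' measurableSet_Ioo).2 h
  simp only [intervalIntegral.integral_of_le hab, ← integral_Icc_eq_integral_Ioc] at h1 h2
  linarith

end AbsolutelyContinuousOnInterval

theorem deriv_norm_le_of_inner_le {V : Type*} [NormedAddCommGroup V] [InnerProductSpace ℝ V]
    {z : ℝ → V} {z' : V} {s C : ℝ} (hz : HasDerivAt z z' s)
    (hC : inner ℝ (z s) z' ≤ C * ‖z s‖) (h0 : z s = 0 → 0 ≤ C) :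
    deriv (fun r => ‖z r‖) s ≤ C := by
  by_cases h : z s = 0
  · have : IsLocalMin (fun r => ‖z r‖) s :=
      Filter.Eventually.of_forall fun r => by simp [h]
    rw [this.deriv_eq_zero]
    exact h0 h
  · have hpos : 0 < ‖z s‖ := norm_pos_iff.2 h
    have h1 : HasDerivAt (fun r => ‖z r‖ ^ 2) (2 * inner ℝ (z s) z') s := hz.norm_sq
    have h2 : DifferentiableAt ℝ (fun r => ‖z r‖) s := hz.differentiableAt.norm ℝ h
    have h3 := (h2.hasDerivAt.pow 2).unique h1
    simp only [Nat.cast_ofNat, Nat.add_one_sub_one, pow_one] at h3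
    nlinarith

/-! ### Comparison along hybrid arcs -/

/-- A function that is locally absolutely continuous on every slice of `S`. -/
def IsHybridArc {X : Type*} [PseudoMetricSpace X] (S : Set (ℝ × ℕ)) (v : ℝ → ℕ → X) : Prop :=
  ∀ j a b, a ≤ b → Icc a b ⊆ timeSlice S j → AbsolutelyContinuousOnInterval (fun s => v s j) a b

namespace IsHybridArc

variable {S : Set (ℝ × ℕ)}

theorem comp_lipschitz {X Y : Type*} [PseudoMetricSpace X] [PseudoMetricSpace Y] {v : ℝ → ℕ → X}
    (hv : IsHybridArc S v) {L : X → Y} {K : NNReal} (hL : LipschitzWith K L) :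
    IsHybridArc S fun s k => L (v s k) :=
  fun j a b hab hs => (hv j a b hab hs).comp_lipschitz hL

theorem continuousOn {X : Type*} [SeminormedAddCommGroup X] {v : ℝ → ℕ → X}
    (hv : IsHybridArc S v) {j : ℕ} {a b : ℝ} (h : Icc a b ⊆ timeSlice S j) :
    ContinuousOn (fun s => v s j) (Icc a b) := by
  rcases le_or_gt a b with hab | hab
  · simpa [uIcc_of_le hab] using (hv j a b hab h).continuousOn
  · simp [Icc_eq_empty_of_lt hab]

theorem Ioo_subset_interior {k : ℕ} {s s' : ℝ} (h : Icc s s' ⊆ timeSlice S k) :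
    Ioo s s' ⊆ interior (timeSlice S k) :=
  interior_maximal (Ioo_subset_Icc_self.trans h) isOpen_Ioo

theorem ae_differentiableAt {v : ℝ → ℕ → ℝ} (hv : IsHybridArc S v) {k : ℕ} {s s' : ℝ}
    (hss : s ≤ s') (h : Icc s s' ⊆ timeSlice S k) :
    ∀ᵐ r, r ∈ Ioo s s' → DifferentiableAt ℝ (fun r => v r k) r := by
  filter_upwards [(hv k s s' hss h).ae_differentiableAt] with r hr hmem
  exact hr (by rw [uIcc_of_le hss]; exact Ioo_subset_Icc_self hmem)

/-- Comparison with a constant rate of growth in hybrid time. -/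
theorem le_add_mul {v : ℝ → ℕ → ℝ} (hv : IsHybridArc S v) (hS : IsHybridTimeDomain S)
    {a b : ℝ × ℕ} (ha : a ∈ S) (hb : b ∈ S) (hab : a ≤ b) {c : ℝ}
    (hflow : ∀ k, a.2 ≤ k → k ≤ b.2 → ∀ᵐ s, s ∈ interior (timeSlice S k) → a.1 ≤ s → s ≤ b.1 →
      DifferentiableAt ℝ (fun r => v r k) s → deriv (fun r => v r k) s ≤ c)
    (hjump : ∀ k s, a.2 ≤ k → k < b.2 → a.1 ≤ s → s ≤ b.1 → (s, k) ∈ jumpPoints S →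
      v s (k + 1) ≤ v s k + c) :
    v b.1 b.2 ≤ v a.1 a.2 + c * ((b.1 - a.1) + ((b.2 : ℝ) - a.2)) := by
  refine hS.induction ha hb hab
    (P := fun s k => v s k ≤ v a.1 a.2 + c * ((s - a.1) + ((k : ℝ) - a.2))) (by simp) ?_ ?_
  · intro k s s' h1 h2 h3 h4 h5 hs hs' ih
    have hsub : Icc s s' ⊆ timeSlice S k := fun r hr => hS.mem_of_mem_Icc hs hs' hr
    have := (hv k s s' h4 hsub).le_add_integral h4 (f := fun _ => c) (by simp) (by
      filter_upwards [hflow k h1 h2, hv.ae_differentiableAt h4 hsub] with r hr hd hmem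
      exact hr (Ioo_subset_interior hsub hmem) (h3.trans hmem.1.le) (hmem.2.le.trans h5)
        (hd hmem))
    simp only [integral_const, MeasurableSet.univ, measureReal_restrict_apply, univ_inter,
      Real.volume_real_Icc_of_le h4, smul_eq_mul] at this
    linarith
  · intro k s h1 h2 h3 h4 hs ih
    have := hjump k s h1 h2 h3 h4 hs
    push_cast
    linarith

/-- Comparison with a variable rate of growth. -/
theorem le_add_sum_integral {v f : ℝ → ℕ → ℝ} {g : ℕ → ℝ} (hv : IsHybridArc S v)
    (hS : IsHybridTimeDomain S) {a b : ℝ × ℕ} (ha : a ∈ S) (hb : b ∈ S) (hab : a ≤ b)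
    (hf : ∀ k c d, Icc c d ⊆ timeSlice S k → ContinuousOn (fun s => f s k) (Icc c d))
    (hflow : ∀ k, a.2 ≤ k → k ≤ b.2 → ∀ᵐ s, s ∈ interior (timeSlice S k) → a.1 ≤ s → s ≤ b.1 →
      DifferentiableAt ℝ (fun r => v r k) s → deriv (fun r => v r k) s ≤ f s k)
    (hjump : ∀ k s, a.2 ≤ k → k < b.2 → a.1 ≤ s → s ≤ b.1 → (s, k) ∈ jumpPoints S →
      v s (k + 1) ≤ v s k + g k) :
    v b.1 b.2 ≤ v a.1 a.2
      + (∑ k ∈ Finset.Icc a.2 b.2, ∫ s in timeSlice S k ∩ Icc a.1 b.1, f s k)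
      + ∑ k ∈ Finset.Ico a.2 b.2, g k := by
  have slice_eq : ∀ {j k : ℕ} {s s' : ℝ}, j < k → k ≤ b.2 → s ≤ s' → s' ≤ b.1 → (s, k) ∈ S →
      timeSlice S j ∩ Icc a.1 s' = timeSlice S j ∩ Icc a.1 s := by
    intro j k s s' hjk hk hss hs' hs
    ext r
    refine ⟨fun hr => ⟨hr.1, hr.2.1, ?_⟩, fun hr => ⟨hr.1, hr.2.1, hr.2.2.trans hss⟩⟩
    exact hS.fst_le_of_lt hb hr.1 hs (hr.2.2.trans hs') (hss.trans hs') hk hjk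
  have hsing : ∀ {k : ℕ} {s : ℝ}, (s, k) ∈ S → ∀ (φ : ℝ → ℝ),
      (∀ r, (r, k) ∈ S → r ∈ Icc a.1 s → r = s) →
      ∫ r in timeSlice S k ∩ Icc a.1 s, φ r = 0 := by
    intro k s hs φ h
    have : volume (timeSlice S k ∩ Icc a.1 s) = 0 :=
      Set.Subsingleton.measure_zero
        (fun x hx y hy => (h x hx.1 hx.2).trans (h y hy.1 hy.2).symm) _
    rw [Measure.restrict_eq_zero.2 this, integral_zero_measure]
  refine hS.induction ha hb hab
    (P := fun s k => v s k ≤ v a.1 a.2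
      + (∑ j ∈ Finset.Icc a.2 k, ∫ r in timeSlice S j ∩ Icc a.1 s, f r j)
      + ∑ j ∈ Finset.Ico a.2 k, g j) ?_ ?_ ?_
  · simp only [Finset.Icc_self, Finset.sum_singleton, Finset.Ico_self, Finset.sum_empty]
    rw [hsing ha _ fun r _ hr => le_antisymm hr.2 hr.1]
    simp
  · intro k s s' h1 h2 h3 h4 h5 hs hs' ih
    have hsub : Icc s s' ⊆ timeSlice S k := fun r hr => hS.mem_of_mem_Icc hs hs' hr
    have key := (hv k s s' h4 hsub).le_add_integral h4
      (hf k s s' hsub).integrableOn_Icc (by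
      filter_upwards [hflow k h1 h2, hv.ae_differentiableAt h4 hsub] with r hr hd hmem
      exact hr (Ioo_subset_interior hsub hmem) (h3.trans hmem.1.le) (hmem.2.le.trans h5)
        (hd hmem))
    have hsplit : ∫ r in timeSlice S k ∩ Icc a.1 s', f r k
        = (∫ r in timeSlice S k ∩ Icc a.1 s, f r k) + ∫ r in Icc s s', f r k := by
      obtain ⟨c, d, hcd⟩ := hS.exists_slice_eq_Icc hs (r := a.1)
        (le_refl k)
      have hsub' : Icc c d ⊆ timeSlice S k := hcd ▸ inter_subset_left
      have hU : timeSlice S k ∩ Icc a.1 s' = (timeSlice S k ∩ Icc a.1 s) ∪ Ioc s s' := by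
        ext r
        constructor
        · rintro ⟨e1, e2⟩
          rcases le_or_gt r s with h | h
          · exact Or.inl ⟨e1, e2.1, h⟩
          · exact Or.inr ⟨h, e2.2⟩
        · rintro (⟨e1, e2⟩ | e)
          · exact ⟨e1, e2.1, e2.2.trans h4⟩
          · exact ⟨hsub ⟨e.1.le, e.2⟩, h3.trans e.1.le, e.2⟩
      rw [hU, integral_Icc_eq_integral_Ioc]
      refine setIntegral_union ?_ measurableSet_Ioc ?_ ?_
      · exact Set.disjoint_left.2 fun r hr hr' => hr'.1.not_ge hr.2.2
      · rw [hcd]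
        exact (hf k c d hsub').integrableOn_Icc
      · exact (hf k s s' hsub).integrableOn_Icc.mono_set Ioc_subset_Icc_self
    have hsum : ∀ r, ∑ j ∈ Finset.Icc a.2 k, ∫ x in timeSlice S j ∩ Icc a.1 r, f x j
        = (∑ j ∈ Finset.Ico a.2 k, ∫ x in timeSlice S j ∩ Icc a.1 r, f x j)
          + ∫ x in timeSlice S k ∩ Icc a.1 r, f x k := by
      intro r
      rw [← Finset.Ico_insert_right h1, Finset.sum_insert (by simp), add_comm]
    rw [hsum] at ih ⊢
    have hcongr : ∑ j ∈ Finset.Ico a.2 k, ∫ x in timeSlice S j ∩ Icc a.1 s', f x j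
        = ∑ j ∈ Finset.Ico a.2 k, ∫ x in timeSlice S j ∩ Icc a.1 s, f x j :=
      Finset.sum_congr rfl fun j hj => by
        rw [slice_eq (Finset.mem_Ico.1 hj).2 h2 h4 h5 hs]
    rw [hcongr, hsplit]
    linarith
  · intro k s h1 h2 h3 h4 hs ih
    have := hjump k s h1 h2 h3 h4 hs
    rw [Finset.sum_Ico_succ_top h1, ← Finset.insert_Icc_right_eq_Icc_add_one (by omega),
      Finset.sum_insert (by simp), hsing hs.2 _ fun r hr hr' => le_antisymm hr'.2 ?_]
    · linarith
    · exact hS.fst_le_of_lt hb hs.1 hr h4 (hr'.2.trans h4) h2 (Nat.lt_succ_self k)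

end IsHybridArc

/-! ### Matrices acting on Euclidean vectors -/

section mulE

variable {n p : ℕ}

theorem mulE_add (M : Matrix (Fin n) (Fin p) ℝ) (v w : EuclideanSpace ℝ (Fin p)) :
    mulE M (v + w) = mulE M v + mulE M w := by
  simp [mulE, Matrix.mulVec_add]

theorem mulE_sub (M : Matrix (Fin n) (Fin p) ℝ) (v w : EuclideanSpace ℝ (Fin p)) :
    mulE M (v - w) = mulE M v - mulE M w := by
  simp [mulE, Matrix.mulVec_sub]

theorem add_mulE (M N : Matrix (Fin n) (Fin p) ℝ) (v : EuclideanSpace ℝ (Fin p)) :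
    mulE (M + N) v = mulE M v + mulE N v := by
  simp [mulE, Matrix.add_mulVec]

theorem smul_mulE (c : ℝ) (M : Matrix (Fin n) (Fin p) ℝ) (v : EuclideanSpace ℝ (Fin p)) :
    mulE (c • M) v = c • mulE M v := by
  simp [mulE, Matrix.smul_mulVec]

theorem inner_mulE_transpose (M : Matrix (Fin n) (Fin p) ℝ) (v : EuclideanSpace ℝ (Fin p))
    (w : EuclideanSpace ℝ (Fin n)) : inner ℝ v (mulE Mᵀ w) = inner ℝ (mulE M v) w := by
  simp only [mulE, EuclideanSpace.inner_eq_star_dotProduct, star_trivial]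
  rw [dotProduct_comm, Matrix.dotProduct_mulVec, Matrix.vecMul_transpose, dotProduct_comm]

theorem norm_mulE_le (M : Matrix (Fin n) (Fin p) ℝ) (v : EuclideanSpace ℝ (Fin p)) :
    ‖mulE M v‖ ≤ specNorm M * ‖v‖ :=
  Matrix.l2_opNorm_mulVec M v

theorem specNorm_nonneg (M : Matrix (Fin n) (Fin p) ℝ) : 0 ≤ specNorm M := by
  open scoped Matrix.Norms.L2Operator in exact norm_nonneg M

theorem specNorm_transpose (M : Matrix (Fin n) (Fin p) ℝ) : specNorm Mᵀ = specNorm M := by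
  have := Matrix.l2_opNorm_conjTranspose M
  rwa [Matrix.conjTranspose_eq_transpose_of_trivial] at this

theorem norm_mulE_transpose_le (M : Matrix (Fin n) (Fin p) ℝ) (v : EuclideanSpace ℝ (Fin n)) :
    ‖mulE Mᵀ v‖ ≤ specNorm M * ‖v‖ :=
  specNorm_transpose M ▸ norm_mulE_le Mᵀ v

theorem frobNorm_sq (M : Matrix (Fin n) (Fin p) ℝ) : frobNorm M ^ 2 = ∑ i, ∑ j, M i j ^ 2 := by
  have h := Matrix.frobenius_norm_def M
  rw [← Real.sqrt_eq_rpow] at h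
  change frobNorm M = _ at h
  rw [h, Real.sq_sqrt (by positivity)]
  simp

theorem frobNorm_nonneg (M : Matrix (Fin n) (Fin p) ℝ) : 0 ≤ frobNorm M := by
  open scoped Matrix.Norms.Frobenius in exact norm_nonneg M

theorem frobNorm_eq (M : Matrix (Fin n) (Fin p) ℝ) :
    frobNorm M = ‖(WithLp.toLp 2 fun q : Fin n × Fin p => M q.1 q.2 :
      EuclideanSpace ℝ (Fin n × Fin p))‖ := by
  rw [← sq_eq_sq₀ (frobNorm_nonneg M) (norm_nonneg _), frobNorm_sq, EuclideanSpace.norm_sq_eq,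
    Fintype.sum_prod_type]
  simp

theorem norm_mulE_le_frobNorm (M : Matrix (Fin n) (Fin p) ℝ) (v : EuclideanSpace ℝ (Fin p)) :
    ‖mulE M v‖ ≤ frobNorm M * ‖v‖ := by
  rw [← sq_le_sq₀ (norm_nonneg _) (mul_nonneg (frobNorm_nonneg M) (norm_nonneg v)), mul_pow,
    frobNorm_sq, EuclideanSpace.norm_sq_eq, EuclideanSpace.norm_sq_eq, Finset.sum_mul]
  refine Finset.sum_le_sum fun i _ => ?_
  simp only [mulE, Real.norm_eq_abs, sq_abs]
  exact Finset.sum_mul_sq_le_sq_mul_sq Finset.univ (fun j => M i j) fun j => v j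

theorem specNorm_le_frobNorm (M : Matrix (Fin n) (Fin p) ℝ) : specNorm M ≤ frobNorm M :=
  ContinuousLinearMap.opNorm_le_bound _ (frobNorm_nonneg M) fun v => norm_mulE_le_frobNorm M v

theorem norm_mulE_sq (M : Matrix (Fin n) (Fin p) ℝ) (v : EuclideanSpace ℝ (Fin p)) :
    ‖mulE M v‖ ^ 2 = v.ofLp ⬝ᵥ (Mᵀ * M) *ᵥ v.ofLp := by
  rw [← real_inner_self_eq_norm_sq, ← inner_mulE_transpose, EuclideanSpace.inner_eq_star_dotProduct,
    star_trivial, dotProduct_comm]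
  simp [mulE, Matrix.mulVec_mulVec]

end mulE

/-- The quadratic form of the excitation matrix. -/
theorem dotProduct_excitation_mulVec {n p : ℕ} {S : Set (ℝ × ℕ)}
    {ψ : ℝ → ℕ → Matrix (Fin n) (Fin p) ℝ} {a b : ℝ × ℕ}
    (hint : ∀ k ∈ Finset.Icc a.2 b.2, ∀ r c, IntegrableOn (fun s => ((ψ s k)ᵀ * ψ s k) r c)
      (timeSlice S k ∩ Icc a.1 b.1)) (v : EuclideanSpace ℝ (Fin p)) :
    v.ofLp ⬝ᵥ (excitation S ψ a b *ᵥ v.ofLp) =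
      (∑ k ∈ Finset.Icc a.2 b.2, ∫ s in timeSlice S k ∩ Icc a.1 b.1, ‖mulE (ψ s k) v‖ ^ 2)
      + ∑ k ∈ Finset.Ico a.2 b.2, ‖mulE (ψ (jumpTime S (k + 1)) (k + 1)) v‖ ^ 2 := by
  simp only [excitation, Matrix.add_mulVec, dotProduct_add, Matrix.sum_mulVec, dotProduct_sum,
    norm_mulE_sq]
  congr 1
  refine Finset.sum_congr rfl fun k hk => ?_
  simp only [dotProduct, Matrix.mulVec, Matrix.of_apply]
  rw [integral_finsetSum]
  · refine Finset.sum_congr rfl fun r _ => ?_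
    rw [integral_const_mul, integral_finsetSum]
    · congr 1
      exact Finset.sum_congr rfl fun c _ => (integral_mul_const _ _).symm
    · exact fun c _ => (hint k hk r c).mul_const _
  · exact fun r _ => (integrable_finsetSum _ fun c _ => (hint k hk r c).mul_const _).const_mul _

theorem mul_norm_sq_le_of_posSemidef {p : ℕ} {M : Matrix (Fin p) (Fin p) ℝ} {μ : ℝ}
    (h : (M - μ • (1 : Matrix (Fin p) (Fin p) ℝ)).PosSemidef) (v : EuclideanSpace ℝ (Fin p)) :
    μ * ‖v‖ ^ 2 ≤ v.ofLp ⬝ᵥ (M *ᵥ v.ofLp) := by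
  have := h.dotProduct_mulVec_nonneg v.ofLp
  rw [star_trivial, Matrix.sub_mulVec, dotProduct_sub, Matrix.smul_mulVec, Matrix.one_mulVec,
    dotProduct_smul, smul_eq_mul, sub_nonneg] at this
  have e : ‖v‖ ^ 2 = v.ofLp ⬝ᵥ v.ofLp := by
    rw [EuclideanSpace.norm_sq_eq]
    simp [dotProduct, sq]
  rwa [e]

theorem specNorm_div_le {n p : ℕ} (M : Matrix (Fin n) (Fin p) ℝ) {γ : ℝ} (hγ : 0 < γ) :
    1 / (γ + specNorm M ^ 2) * specNorm M ≤ 1 / (2 * √γ) := by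
  have hs := Real.sqrt_pos.2 hγ
  have := specNorm_nonneg M
  rw [one_div_mul_eq_div, div_le_div_iff₀ (by positivity) (by positivity)]
  nlinarith [sq_nonneg (√γ - specNorm M), Real.sq_sqrt hγ.le]

/-! ### Stable scalar filters -/

/-- Input-to-state bound for `y' = -λ y + α`, `y⁺ = (1 - λ_d) y + β` with inputs bounded by `D`. -/
theorem IsHybridArc.norm_le_of_filter {V : Type*} [NormedAddCommGroup V] [InnerProductSpace ℝ V]
    {S : Set (ℝ × ℕ)} {y : ℝ → ℕ → V} (hy : IsHybridArc S y) (hS : IsHybridTimeDomain S)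
    {b : ℝ × ℕ} (hb : b ∈ S) {lam ld l D R : ℝ} (hlam : 0 < lam) (hll : l ≤ lam)
    (hld : |1 - ld| ≤ Real.exp (-l)) (hD : 0 ≤ D) (hDR : D ≤ lam * R)
    (hDR' : D ≤ (1 - |1 - ld|) * R)
    (hflow : ∀ k, k ≤ b.2 → ∀ᵐ s, s ∈ interior (timeSlice S k) → s ≤ b.1 →
      ∃ α, ‖α‖ ≤ D ∧ HasDerivAt (fun r => y r k) (-lam • y s k + α) s)
    (hjump : ∀ k s, k < b.2 → s ≤ b.1 → (s, k) ∈ jumpPoints S →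
      ∃ β, ‖β‖ ≤ D ∧ y s (k + 1) = (1 - ld) • y s k + β) :
    ‖y b.1 b.2‖ ≤ Real.exp (-l * (b.1 + b.2)) * ‖y 0 0‖ + R := by
  have hR : 0 ≤ R := nonneg_of_mul_nonneg_right (hD.trans hDR) hlam
  refine hS.induction hS.zero_mem hb ⟨hS.fst_nonneg (k := b.2) hb, Nat.zero_le _⟩
    (P := fun s k => ‖y s k‖ ≤ Real.exp (-l * (s + k)) * ‖y 0 0‖ + R) (by simpa using hR) ?_ ?_
  · intro k s s' _ hk _ hss hs'b hs hs' ih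
    have hsub : Icc s s' ⊆ timeSlice S k := fun r hr => hS.mem_of_mem_Icc hs hs' hr
    have hN : IsHybridArc S fun r j => ‖y r j‖ := hy.comp_lipschitz lipschitzWith_one_norm
    have hexp : AbsolutelyContinuousOnInterval (fun r => Real.exp (lam * r)) s s' :=
      ContDiffOn.absolutelyContinuousOnInterval (by fun_prop)
    have hconst : AbsolutelyContinuousOnInterval (fun _ : ℝ => R) s s' :=
      ContDiffOn.absolutelyContinuousOnInterval (by fun_prop)
    have hw := (((hN k s s' hss hsub).fun_sub hconst).fun_mul hexp).le_add_integral hss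
      (f := fun _ => 0) (by simp) (by
        filter_upwards [hflow k hk, hN.ae_differentiableAt hss hsub] with r hr hd hmem
        obtain ⟨α, hα, hder⟩ := hr (Ioo_subset_interior hsub hmem) (hmem.2.le.trans hs'b)
        have h1 : deriv (fun r => ‖y r k‖) r ≤ -lam * ‖y r k‖ + D := by
          refine deriv_norm_le_of_inner_le hder ?_ fun h => by simpa [h] using hD
          rw [inner_add_right, inner_smul_right, real_inner_self_eq_norm_sq]
          nlinarith [real_inner_le_norm (y r k) α, norm_nonneg (y r k),
            mul_le_mul_of_nonneg_left hα (norm_nonneg (y r k))]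
        have h2 : HasDerivAt (fun r => Real.exp (lam * r)) (Real.exp (lam * r) * lam) r := by
          simpa using ((hasDerivAt_id r).const_mul lam).exp
        have h3 := (((hd hmem).hasDerivAt.sub_const R).fun_mul h2).deriv
        rw [h3]
        nlinarith [Real.exp_pos (lam * r)])
    simp only [integral_zero, add_zero] at hw
    have h4 : ‖y s' k‖ - R ≤ Real.exp (-lam * (s' - s)) * (‖y s k‖ - R) := by
      have : Real.exp (-lam * (s' - s)) = Real.exp (lam * s) / Real.exp (lam * s') := by
        rw [← Real.exp_sub]
        ring_nf
      rw [this, div_mul_eq_mul_div, le_div_iff₀ (Real.exp_pos _)]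
      linarith
    have h5 : Real.exp (-lam * (s' - s)) * (‖y s k‖ - R) ≤
        Real.exp (-l * (s' - s)) * (Real.exp (-l * (s + k)) * ‖y 0 0‖) := by
      refine (mul_le_mul_of_nonneg_left (sub_le_iff_le_add.2 ih) (Real.exp_pos _).le).trans ?_
      refine mul_le_mul_of_nonneg_right (Real.exp_le_exp.2 ?_) (by positivity)
      nlinarith
    rw [← mul_assoc, ← Real.exp_add, show -l * (s' - s) + -l * (s + k) = -l * (s' + k) by ring]
      at h5
    linarith
  · intro k s _ hk _ hs hj ih
    obtain ⟨β, hβ, he⟩ := hjump k s hk hs hj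
    have h1 : ‖y s (k + 1)‖ ≤ |1 - ld| * ‖y s k‖ + D := by
      rw [he]
      refine (norm_add_le _ _).trans ?_
      rw [norm_smul, Real.norm_eq_abs]
      linarith
    have h2 := mul_le_mul_of_nonneg_left ih (abs_nonneg (1 - ld))
    have h3 : |1 - ld| * (Real.exp (-l * (s + k)) * ‖y 0 0‖) ≤
        Real.exp (-l) * (Real.exp (-l * (s + k)) * ‖y 0 0‖) :=
      mul_le_mul_of_nonneg_right hld (by positivity)
    rw [← mul_assoc (Real.exp (-l)), ← Real.exp_add,
      show -l + -l * (s + k) = -l * (s + (k + 1 : ℕ)) by push_cast; ring] at h3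
    nlinarith

/-! ### Elementary optimisation -/

theorem le_of_forall_pos_le_mul {A B C : ℝ} (hC : 0 ≤ C) (h : ∀ ε > 0, A ≤ B + ε * C) :
    A ≤ B := by
  by_contra! hlt
  have := h ((A - B) / (2 * (C + 1))) (by have := sub_pos.2 hlt; positivity)
  have h2 : (A - B) / (2 * (C + 1)) * C ≤ (A - B) / 2 := by
    rw [div_mul_eq_mul_div, div_le_div_iff₀ (by positivity) (by positivity)]
    nlinarith
  linarith

theorem sqrt_le_of_forall_div {A Y B : ℝ} (hY : 0 ≤ Y) (hB : 0 ≤ B)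
    (h : ∀ r > 0, A / (1 + r) ≤ Y + B / r) : √A ≤ √Y + √B := by
  refine Real.sqrt_le_iff.2 ⟨by positivity, ?_⟩
  refine le_of_forall_pos_le_mul (C := √Y + √B) (by positivity) fun ε hε => ?_
  have hy := Real.sqrt_nonneg Y
  have hb := Real.sqrt_nonneg B
  have h1 := h ((√B + ε) / (√Y + ε)) (by positivity)
  rw [div_le_iff₀ (by positivity), div_div_eq_mul_div] at h1
  have e : (Y + B * (√Y + ε) / (√B + ε)) * (1 + (√B + ε) / (√Y + ε))
      = Y + B + Y / (√Y + ε) * (√B + ε) + B / (√B + ε) * (√Y + ε) := by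
    field_simp
    ring
  have e1 : Y / (√Y + ε) ≤ √Y := by
    rw [div_le_iff₀ (by positivity)]
    nlinarith [Real.sq_sqrt hY]
  have e2 : B / (√B + ε) ≤ √B := by
    rw [div_le_iff₀ (by positivity)]
    nlinarith [Real.sq_sqrt hB]
  nlinarith [mul_le_mul_of_nonneg_right e1 (by positivity : 0 ≤ √B + ε),
    mul_le_mul_of_nonneg_right e2 (by positivity : 0 ≤ √Y + ε), Real.sq_sqrt hY, Real.sq_sqrt hB]

theorem le_two_mul_sqrt_of_forall {x α β : ℝ} (hα : 0 ≤ α) (hβ : 0 < β)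
    (h : ∀ c > 0, x ≤ α / c + β * c) : x ≤ 2 * √(α * β) := by
  have hb := Real.sqrt_pos.2 hβ
  refine le_of_forall_pos_le_mul (C := √β) hb.le fun ε hε => ?_
  have h1 := h ((√α + ε) / √β) (by positivity)
  rw [Real.sqrt_mul hα]
  have e1 : α / ((√α + ε) / √β) ≤ √α * √β := by
    rw [div_div_eq_mul_div, div_le_iff₀ (by positivity)]
    nlinarith [Real.sq_sqrt hα, mul_nonneg (mul_nonneg (Real.sqrt_nonneg α) hb.le) hε.le]
  have e2 : β * ((√α + ε) / √β) = √β * (√α + ε) := by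
    field_simp
    rw [Real.sq_sqrt hβ.le]
  nlinarith

theorem sq_div_le_of_le_add {x q w r : ℝ} (hx : 0 ≤ x) (h : x ≤ q + w) (hr : 0 < r) :
    x ^ 2 / (1 + r) ≤ q ^ 2 + w ^ 2 / r := by
  have h1 : x ^ 2 ≤ (q + w) ^ 2 := by gcongr
  rw [div_le_iff₀ (by positivity)]
  have e : (q ^ 2 + w ^ 2 / r) * (1 + r) - (q + w) ^ 2 = (r * q - w) ^ 2 / r := by
    field_simp
    ring
  have : 0 ≤ (r * q - w) ^ 2 / r := by positivity
  linarith

/-! ### Perturbed gradient estimators -/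

/-- Up to the horizon `b`, the arc `z` solves `z' = -γ_c ψᵀψ z + d`,
`z⁺ = z - ψ⁺ᵀψ⁺ z / (γ_d + |ψ⁺|²) + d` with inputs bounded by `D` and `|ψ| ≤ ψ_M`. -/
structure IsPerturbedGradientArc {n p : ℕ} (S : Set (ℝ × ℕ)) (z : ℝ → ℕ → EuclideanSpace ℝ (Fin p))
    (ψ : ℝ → ℕ → Matrix (Fin n) (Fin p) ℝ) (γc γd ψM D : ℝ) (b : ℝ × ℕ) : Prop where
  dom : IsHybridTimeDomain S
  arc : IsHybridArc S z
  continuousOn : ∀ k c d, Icc c d ⊆ timeSlice S k → ContinuousOn (fun s => ψ s k) (Icc c d)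
  γc_pos : 0 < γc
  γd_pos : 0 < γd
  D_nonneg : 0 ≤ D
  bound : ∀ s k, (s, k) ∈ S → s ≤ b.1 → k ≤ b.2 → specNorm (ψ s k) ≤ ψM
  flow : ∀ k, k ≤ b.2 → ∀ᵐ s, s ∈ interior (timeSlice S k) → s ≤ b.1 →
    ∃ d, ‖d‖ ≤ D ∧
      HasDerivAt (fun r => z r k) (-(γc • mulE (ψ s k)ᵀ (mulE (ψ s k) (z s k))) + d) s
  jump : ∀ k s, k < b.2 → s ≤ b.1 → (s, k) ∈ jumpPoints S →
    ∃ d, ‖d‖ ≤ D ∧ z s (k + 1) = z s k - (1 / (γd + specNorm (ψ s (k + 1)) ^ 2)) •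
      mulE (ψ s (k + 1))ᵀ (mulE (ψ s (k + 1)) (z s k)) + d

theorem mem_of_mem_interior_timeSlice {S : Set (ℝ × ℕ)} {s : ℝ} {k : ℕ}
    (h : s ∈ interior (timeSlice S k)) : (s, k) ∈ S :=
  interior_subset (s := timeSlice S k) h

theorem integrableOn_gram {n p : ℕ} {S : Set (ℝ × ℕ)} (hS : IsHybridTimeDomain S)
    {ψ : ℝ → ℕ → Matrix (Fin n) (Fin p) ℝ}
    (hψ : ∀ k c d, Icc c d ⊆ timeSlice S k → ContinuousOn (fun s => ψ s k) (Icc c d))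
    {c : ℝ × ℕ} (hc : c ∈ S) {k : ℕ} (hk : k ≤ c.2) (t : ℝ) (i j : Fin p) :
    IntegrableOn (fun s => ((ψ s k)ᵀ * ψ s k) i j) (timeSlice S k ∩ Icc t c.1) := by
  obtain ⟨u, v, huv⟩ := hS.exists_slice_eq_Icc hc (r := t) hk
  rw [huv]
  have := hψ k u v (huv ▸ inter_subset_left)
  have : ContinuousOn (fun s => (ψ s k)ᵀ * ψ s k) (Icc u v) := by fun_prop
  exact ((continuousOn_pi.1 ((continuousOn_pi.1 this) i)) j).integrableOn_Icc

section pointwise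

variable {n p : ℕ} (M : Matrix (Fin n) (Fin p) ℝ) (z d : EuclideanSpace ℝ (Fin p)) {γ D : ℝ}

theorem inner_gradient_flow_le (hd : ‖d‖ ≤ D) :
    inner ℝ z (-(γ • mulE Mᵀ (mulE M z)) + d) ≤ -γ * ‖mulE M z‖ ^ 2 + D * ‖z‖ := by
  rw [inner_add_right, inner_neg_right, inner_smul_right, inner_mulE_transpose,
    real_inner_self_eq_norm_sq]
  nlinarith [real_inner_le_norm z d, mul_le_mul_of_nonneg_left hd (norm_nonneg z)]

theorem norm_gradient_flow_le {ψM : ℝ} (hγ : 0 ≤ γ) (hM : specNorm M ≤ ψM) (hd : ‖d‖ ≤ D) :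
    ‖-(γ • mulE Mᵀ (mulE M z)) + d‖ ≤ γ * ψM * ‖mulE M z‖ + D := by
  refine (norm_add_le _ _).trans (add_le_add ?_ hd)
  rw [norm_neg, norm_smul, Real.norm_of_nonneg hγ, mul_assoc]
  exact mul_le_mul_of_nonneg_left ((norm_mulE_transpose_le _ _).trans
    (mul_le_mul_of_nonneg_right hM (norm_nonneg _))) hγ

theorem norm_sq_gradient_step_le (hγ : 0 < γ) :
    ‖z - (1 / (γ + specNorm M ^ 2)) • mulE Mᵀ (mulE M z)‖ ^ 2 ≤
      ‖z‖ ^ 2 - 1 / (γ + specNorm M ^ 2) * ‖mulE M z‖ ^ 2 := by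
  set β := 1 / (γ + specNorm M ^ 2) with hβ
  have hβ0 : 0 < β := by positivity
  have hβ1 : β * specNorm M ^ 2 ≤ 1 := by
    rw [hβ, one_div_mul_eq_div, div_le_one (by positivity)]
    linarith
  rw [norm_sub_sq_real, inner_smul_right, inner_mulE_transpose, real_inner_self_eq_norm_sq,
    norm_smul, Real.norm_of_nonneg hβ0.le, mul_pow]
  have h1 : ‖mulE Mᵀ (mulE M z)‖ ^ 2 ≤ (specNorm M * ‖mulE M z‖) ^ 2 := by
    gcongr
    exact norm_mulE_transpose_le _ _
  have h2 : β ^ 2 * ‖mulE Mᵀ (mulE M z)‖ ^ 2 ≤ β * ‖mulE M z‖ ^ 2 := by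
    calc _ ≤ β ^ 2 * (specNorm M * ‖mulE M z‖) ^ 2 := by gcongr
      _ = (β * specNorm M ^ 2) * (β * ‖mulE M z‖ ^ 2) := by ring
      _ ≤ 1 * (β * ‖mulE M z‖ ^ 2) := by gcongr
      _ = _ := one_mul _
  linarith

theorem norm_gradient_step_le (hγ : 0 < γ) :
    ‖z - (1 / (γ + specNorm M ^ 2)) • mulE Mᵀ (mulE M z)‖ ≤ ‖z‖ := by
  refine le_of_sq_le_sq ((norm_sq_gradient_step_le M z hγ).trans ?_) (norm_nonneg z)
  have : 0 ≤ 1 / (γ + specNorm M ^ 2) * ‖mulE M z‖ ^ 2 := by positivity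
  linarith

theorem norm_sq_gradient_step_add_le (hγ : 0 < γ) {B : ℝ} (hz : ‖z‖ ≤ B) (hd : ‖d‖ ≤ D) :
    ‖z - (1 / (γ + specNorm M ^ 2)) • mulE Mᵀ (mulE M z) + d‖ ^ 2 ≤
      ‖z‖ ^ 2 - 1 / (γ + specNorm M ^ 2) * ‖mulE M z‖ ^ 2 + (2 * D * B + D ^ 2) := by
  have h1 := norm_sq_gradient_step_le M z hγ
  have h2 := norm_gradient_step_le M z hγ
  set y := z - (1 / (γ + specNorm M ^ 2)) • mulE Mᵀ (mulE M z)
  have hD : 0 ≤ D := (norm_nonneg d).trans hd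
  have h3 : ‖y + d‖ ^ 2 ≤ (‖y‖ + ‖d‖) ^ 2 := by gcongr; exact norm_add_le _ _
  have h4 : ‖y‖ * ‖d‖ ≤ B * D :=
    mul_le_mul (h2.trans hz) hd (norm_nonneg d) ((norm_nonneg z).trans hz)
  have h5 : ‖d‖ ^ 2 ≤ D ^ 2 := by gcongr
  nlinarith

end pointwise

namespace IsPerturbedGradientArc

variable {n p : ℕ} {S : Set (ℝ × ℕ)} {z : ℝ → ℕ → EuclideanSpace ℝ (Fin p)}
  {ψ : ℝ → ℕ → Matrix (Fin n) (Fin p) ℝ} {γc γd ψM D : ℝ} {b : ℝ × ℕ}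

theorem norm_le (h : IsPerturbedGradientArc S z ψ γc γd ψM D b) {a c : ℝ × ℕ} (ha : a ∈ S)
    (hc : c ∈ S) (hac : a ≤ c) (hcb : c ≤ b) :
    ‖z c.1 c.2‖ ≤ ‖z a.1 a.2‖ + D * ((c.1 - a.1) + ((c.2 : ℝ) - a.2)) := by
  have hN : IsHybridArc S fun r j => ‖z r j‖ := h.arc.comp_lipschitz lipschitzWith_one_norm
  refine hN.le_add_mul h.dom ha hc hac (fun k _ hk => ?_) fun k s _ hk _ hs hj => ?_
  · filter_upwards [h.flow k (hk.trans hcb.2)] with s hs hmem _ hsc _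
    obtain ⟨d, hd, hder⟩ := hs hmem (hsc.trans hcb.1)
    refine deriv_norm_le_of_inner_le hder ?_ fun _ => h.D_nonneg
    have := inner_gradient_flow_le (γ := γc) (ψ s k) (z s k) d hd
    nlinarith [h.γc_pos, sq_nonneg ‖mulE (ψ s k) (z s k)‖,
      mul_nonneg h.γc_pos.le (sq_nonneg ‖mulE (ψ s k) (z s k)‖)]
  · obtain ⟨d, hd, he⟩ := h.jump k s (hk.trans_le hcb.2) (hs.trans hcb.1) hj
    rw [he]
    exact (norm_add_le _ _).trans (add_le_add (norm_gradient_step_le _ _ h.γd_pos) hd)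

variable {a : ℝ × ℕ} {B : ℝ}

theorem hasDerivAt_norm_sq {k : ℕ} {s : ℝ} {z' : EuclideanSpace ℝ (Fin p)}
    (hder : HasDerivAt (fun r => z r k) z' s) :
    HasDerivAt (fun r => ‖z r k‖ ^ 2) (2 * inner ℝ (z s k) z') s := hder.norm_sq

theorem arc_norm_sq (h : IsPerturbedGradientArc S z ψ γc γd ψM D b) :
    IsHybridArc S fun r j => ‖z r j‖ ^ 2 := by
  have hN : IsHybridArc S fun r j => ‖z r j‖ := h.arc.comp_lipschitz lipschitzWith_one_norm
  intro j c d hcd hsub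
  simpa only [sq] using (hN j c d hcd hsub).fun_mul (hN j c d hcd hsub)

theorem norm_sq_le (h : IsPerturbedGradientArc S z ψ γc γd ψM D b) {c : ℝ × ℕ} (ha : a ∈ S)
    (hc : c ∈ S) (hac : a ≤ c) (hcb : c ≤ b)
    (hB : ∀ s k, (s, k) ∈ S → a ≤ (s, k) → (s, k) ≤ c → ‖z s k‖ ≤ B) :
    ‖z c.1 c.2‖ ^ 2 ≤ ‖z a.1 a.2‖ ^ 2
      + (2 * D * B + D ^ 2) * ((c.1 - a.1) + ((c.2 : ℝ) - a.2)) := by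
  refine h.arc_norm_sq.le_add_mul h.dom ha hc hac (fun k hk0 hk => ?_) fun k s hk0 hk h0 hs hj => ?_
  · filter_upwards [h.flow k (hk.trans hcb.2)] with s hs hmem has hsc _
    obtain ⟨d, hd, hder⟩ := hs hmem (hsc.trans hcb.1)
    rw [(hasDerivAt_norm_sq hder).deriv]
    have := inner_gradient_flow_le (γ := γc) (ψ s k) (z s k) d hd
    have h1 := hB s k (mem_of_mem_interior_timeSlice hmem) ⟨has, hk0⟩ ⟨hsc, hk⟩
    nlinarith [h.γc_pos, mul_nonneg h.γc_pos.le (sq_nonneg ‖mulE (ψ s k) (z s k)‖),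
      mul_le_mul_of_nonneg_left h1 h.D_nonneg, sq_nonneg D]
  · obtain ⟨d, hd, he⟩ := h.jump k s (hk.trans_le hcb.2) (hs.trans hcb.1) hj
    rw [he]
    have h1 := hB s k hj.1 ⟨h0, hk0⟩ ⟨hs, hk.le⟩
    have h2 := norm_sq_gradient_step_add_le (ψ s (k + 1)) (z s k) d h.γd_pos h1 hd
    have h3 : 0 ≤ 1 / (γd + specNorm (ψ s (k + 1)) ^ 2)
        * ‖mulE (ψ s (k + 1)) (z s k)‖ ^ 2 := by
      have := h.γd_pos
      positivity
    linarith

/-- The excursion from the value at `a`, bounded through the dissipation of `|z|²`. -/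
theorem excursion_le (h : IsPerturbedGradientArc S z ψ γc γd ψM D b) {e : ℝ × ℕ} (ha : a ∈ S)
    (he : e ∈ S) (hae : a ≤ e) (heb : e ≤ b)
    (hB : ∀ s k, (s, k) ∈ S → a ≤ (s, k) → (s, k) ≤ e → ‖z s k‖ ≤ B) {c : ℝ} (hc : 0 < c) :
    ‖z e.1 e.2 - z a.1 a.2‖ + (γc * ψM ^ 2 + 2) / (4 * c) * ‖z e.1 e.2‖ ^ 2 ≤
      (γc * ψM ^ 2 + 2) / (4 * c) * ‖z a.1 a.2‖ ^ 2
      + (c / 2 + D + (γc * ψM ^ 2 + 2) / (4 * c) * (2 * D * B + D ^ 2))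
        * ((e.1 - a.1) + ((e.2 : ℝ) - a.2)) := by
  set K := (γc * ψM ^ 2 + 2) / (4 * c) with hK
  have hγ := h.γc_pos
  have hK0 : 0 ≤ K := by positivity
  have hK1 : γc * ψM ^ 2 / (4 * c) ≤ K := by rw [hK]; gcongr; linarith
  have hK2 : 1 / (2 * c) ≤ K := by
    rw [hK, div_le_div_iff₀ (by positivity) (by positivity)]
    nlinarith [mul_nonneg hγ.le (sq_nonneg ψM), mul_nonneg (mul_nonneg hγ.le (sq_nonneg ψM)) hc.le]
  have hN : IsHybridArc S fun r j => ‖z r j - z a.1 a.2‖ := by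
    refine h.arc.comp_lipschitz (L := fun y => ‖y - z a.1 a.2‖) (K := 1) ?_
    refine LipschitzWith.of_dist_le_mul fun x y => ?_
    rw [Real.dist_eq, NNReal.coe_one, one_mul, dist_eq_norm]
    refine (abs_norm_sub_norm_le _ _).trans_eq ?_
    rw [sub_sub_sub_cancel_right]
  have hv : IsHybridArc S fun r j => ‖z r j - z a.1 a.2‖ + K * ‖z r j‖ ^ 2 :=
    fun j s t hst hsub => (hN j s t hst hsub).fun_add ((h.arc_norm_sq j s t hst hsub).const_mul K)
  have key := hv.le_add_mul h.dom ha he hae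
    (c := c / 2 + D + K * (2 * D * B + D ^ 2)) (fun k hk0 hk => ?_) fun k s hk0 hk h0 hs hj => ?_
  · simpa using key
  · filter_upwards [h.flow k (hk.trans heb.2)] with s hs hmem has hsc hdiff
    obtain ⟨d, hd, hder⟩ := hs hmem (hsc.trans heb.1)
    have hV := hasDerivAt_norm_sq hder
    have hdiff' : DifferentiableAt ℝ (fun r => ‖z r k - z a.1 a.2‖) s := by
      have := hdiff.fun_sub (hV.differentiableAt.const_mul K)
      simpa using this
    have e1 := (hdiff'.hasDerivAt.fun_add (hV.const_mul K)).deriv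
    rw [e1]
    have hψ := h.bound s k (mem_of_mem_interior_timeSlice hmem) (hsc.trans heb.1) (hk.trans heb.2)
    have h1 := norm_gradient_flow_le (ψ s k) (z s k) d hγ.le hψ hd
    have h2 := inner_gradient_flow_le (γ := γc) (ψ s k) (z s k) d hd
    have h3 : deriv (fun r => ‖z r k - z a.1 a.2‖) s ≤
        γc * ψM * ‖mulE (ψ s k) (z s k)‖ + D := by
      refine (deriv_norm_le_of_inner_le (hder.sub_const _) ?_ fun _ => norm_nonneg _).trans h1
      rw [mul_comm]
      exact real_inner_le_norm _ _
    have h4 := hB s k (mem_of_mem_interior_timeSlice hmem) ⟨has, hk0⟩ ⟨hsc, hk⟩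
    set q := ‖mulE (ψ s k) (z s k)‖
    have h5 : γc * ψM * q ≤ c / 2 + K * (2 * (γc * q ^ 2)) := by
      have : γc * ψM * q ≤ c / 2 + γc * ψM ^ 2 / (4 * c) * (2 * (γc * q ^ 2)) := by
        rw [← sub_nonneg]
        have : c / 2 + γc * ψM ^ 2 / (4 * c) * (2 * (γc * q ^ 2)) - γc * ψM * q
            = (c - γc * ψM * q) ^ 2 / (2 * c) := by
          field_simp
          ring
        rw [this]
        positivity
      have h6 := mul_le_mul_of_nonneg_right hK1 (by positivity : 0 ≤ 2 * (γc * q ^ 2))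
      linarith
    have h7 : K * (2 * inner ℝ (z s k) (-(γc • mulE (ψ s k)ᵀ (mulE (ψ s k) (z s k))) + d)) ≤
        K * (-2 * (γc * q ^ 2) + 2 * D * B + D ^ 2) := by
      refine mul_le_mul_of_nonneg_left ?_ hK0
      nlinarith [mul_le_mul_of_nonneg_left h4 h.D_nonneg, sq_nonneg D]
    linarith
  · obtain ⟨d, hd, hstep⟩ := h.jump k s (hk.trans_le heb.2) (hs.trans heb.1) hj
    have h1 := hB s k hj.1 ⟨h0, hk0⟩ ⟨hs, hk.le⟩
    have h2 := norm_sq_gradient_step_add_le (ψ s (k + 1)) (z s k) d h.γd_pos h1 hd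
    rw [← hstep] at h2
    have hγd := h.γd_pos
    set q := ‖mulE (ψ s (k + 1)) (z s k)‖
    set w := specNorm (ψ s (k + 1))
    set β := 1 / (γd + w ^ 2) with hβ
    have hβ0 : 0 < β := by positivity
    have hβ1 : β * w ^ 2 ≤ 1 := by
      rw [hβ, one_div_mul_eq_div, div_le_one (by positivity)]
      linarith
    have h3 : ‖z s (k + 1) - z a.1 a.2‖ ≤ ‖z s k - z a.1 a.2‖ + β * (w * q) + D := by
      have : z s (k + 1) - z a.1 a.2 = (z s k - z a.1 a.2)
          - β • mulE (ψ s (k + 1))ᵀ (mulE (ψ s (k + 1)) (z s k)) + d := by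
        rw [hstep]
        abel
      rw [this]
      refine (norm_add_le _ _).trans (add_le_add ((norm_sub_le _ _).trans ?_) hd)
      rw [norm_smul, Real.norm_of_nonneg hβ0.le]
      gcongr
      exact norm_mulE_transpose_le _ _
    have h5 : β * (w * q) ≤ c / 2 + K * (β * q ^ 2) := by
      have e1 : β * (w * q) ≤ c / 2 + 1 / (2 * c) * ((β * w ^ 2) * (β * q ^ 2)) := by
        rw [← sub_nonneg]
        have : c / 2 + 1 / (2 * c) * ((β * w ^ 2) * (β * q ^ 2)) - β * (w * q)
            = (c - β * (w * q)) ^ 2 / (2 * c) := by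
          field_simp
          ring
        rw [this]
        positivity
      have e2 : 1 / (2 * c) * ((β * w ^ 2) * (β * q ^ 2)) ≤ K * (1 * (β * q ^ 2)) := by
        gcongr
      linarith
    have h7 := mul_le_mul_of_nonneg_left h2 hK0
    linarith

/-- The dissipation of `|z|²` between `a` and `c` under excitation of level `μ`. -/
theorem norm_sq_le_of_excitation (h : IsPerturbedGradientArc S z ψ γc γd ψM D b) {c : ℝ × ℕ}
    (ha : a ∈ S) (hc : c ∈ S) (hac : a ≤ c) (hcb : c ≤ b)
    (hB : ∀ s k, (s, k) ∈ S → a ≤ (s, k) → (s, k) ≤ c → ‖z s k‖ ≤ B) {δ μ r : ℝ}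
    (hδ : ∀ s k, (s, k) ∈ S → a ≤ (s, k) → (s, k) ≤ c → ‖z s k - z a.1 a.2‖ ≤ δ)
    (hμ : (excitation S ψ a c - μ • (1 : Matrix (Fin p) (Fin p) ℝ)).PosSemidef) (hr : 0 < r) :
    ‖z c.1 c.2‖ ^ 2 ≤ ‖z a.1 a.2‖ ^ 2
      - 2 / (1 + r) * (min γc (1 / (2 * (γd + ψM ^ 2))) * μ) * ‖z a.1 a.2‖ ^ 2
      + (2 / r * (γc * ψM ^ 2 + 1 / 2) * δ ^ 2 + (2 * D * B + D ^ 2))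
        * ((c.1 - a.1) + ((c.2 : ℝ) - a.2)) := by
  have hγ := h.γc_pos
  have hγd := h.γd_pos
  set v := z a.1 a.2 with hv
  set m := min γc (1 / (2 * (γd + ψM ^ 2))) with hm
  have hm0 : 0 < m := by positivity
  set C := 2 / r * (γc * ψM ^ 2 + 1 / 2) * δ ^ 2 + (2 * D * B + D ^ 2) with hC
  have hδ0 : 0 ≤ δ := (norm_nonneg _).trans (hδ a.1 a.2 ha le_rfl hac)
  have hV : IsHybridArc S fun s k => ‖z s k‖ ^ 2 - C * (s + k) := by
    intro j s t hst hsub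
    refine (h.arc_norm_sq j s t hst hsub).fun_sub ?_
    exact ContDiffOn.absolutelyContinuousOnInterval (by fun_prop)
  have hmul : ∀ s k, (s, k) ∈ S → a ≤ (s, k) → (s, k) ≤ c → ∀ M : Matrix (Fin n) (Fin p) ℝ,
      ‖mulE M v‖ ≤ ‖mulE M (z s k)‖ + specNorm M * δ := by
    intro s k h1 h2 h3 M
    have e : mulE M v = mulE M (z s k) - mulE M (z s k - v) := by rw [mulE_sub, sub_sub_cancel]
    rw [e]
    refine (norm_sub_le _ _).trans (add_le_add le_rfl ((norm_mulE_le _ _).trans ?_))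
    exact mul_le_mul_of_nonneg_left (hδ s k h1 h2 h3) (specNorm_nonneg M)
  have key := hV.le_add_sum_integral h.dom ha hc hac
    (f := fun s k => -(2 / (1 + r) * m) * ‖mulE (ψ s k) v‖ ^ 2)
    (g := fun k => -(2 / (1 + r) * m) * ‖mulE (ψ (jumpTime S (k + 1)) (k + 1)) v‖ ^ 2)
    (fun k s t hsub => ?_) (fun k hk0 hk => ?_) fun k s hk0 hk h0 hs hj => ?_
  · have hquad := mul_norm_sq_le_of_posSemidef hμ v
    rw [dotProduct_excitation_mulVec fun k hk i j =>
      integrableOn_gram h.dom h.continuousOn hc (Finset.mem_Icc.1 hk).2 a.1 i j] at hquad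
    simp only [integral_const_mul, ← Finset.mul_sum] at key
    have := mul_le_mul_of_nonneg_left hquad (by positivity : 0 ≤ 2 / (1 + r) * m)
    simp only [mul_add] at this
    linarith
  · have hψ := h.continuousOn k s t hsub
    have : ContinuousOn (fun s => mulE (ψ s k) v) (Icc s t) := by
      unfold mulE
      fun_prop
    fun_prop
  · filter_upwards [h.flow k (hk.trans hcb.2)] with s hs hmem has hsc _
    obtain ⟨d, hd, hder⟩ := hs hmem (hsc.trans hcb.1)
    have hmem' := mem_of_mem_interior_timeSlice hmem
    have hlin : HasDerivAt (fun r : ℝ => C * (r + k)) C s := by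
      simpa using ((hasDerivAt_id s).add_const (k : ℝ)).const_mul C
    rw [((hasDerivAt_norm_sq hder).fun_sub hlin).deriv]
    have h2 := inner_gradient_flow_le (γ := γc) (ψ s k) (z s k) d hd
    have h4 := hB s k hmem' ⟨has, hk0⟩ ⟨hsc, hk⟩
    have hψ := h.bound s k hmem' (hsc.trans hcb.1) (hk.trans hcb.2)
    have h5 := sq_div_le_of_le_add (norm_nonneg _)
      (hmul s k hmem' ⟨has, hk0⟩ ⟨hsc, hk⟩ (ψ s k)) hr
    have h6 : (specNorm (ψ s k) * δ) ^ 2 / r ≤ (ψM * δ) ^ 2 / r := by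
      have := specNorm_nonneg (ψ s k)
      gcongr
    have h7 : 2 / (1 + r) * m * ‖mulE (ψ s k) v‖ ^ 2 ≤
        2 * γc * (‖mulE (ψ s k) v‖ ^ 2 / (1 + r)) := by
      rw [show 2 / (1 + r) * m * ‖mulE (ψ s k) v‖ ^ 2
        = 2 * m * (‖mulE (ψ s k) v‖ ^ 2 / (1 + r)) by ring]
      gcongr
      exact min_le_left _ _
    have h8 := mul_le_mul_of_nonneg_left (h5.trans (add_le_add le_rfl h6))
      (by positivity : 0 ≤ 2 * γc)
    have h9 : 2 * γc * ((ψM * δ) ^ 2 / r) ≤ 2 / r * (γc * ψM ^ 2 + 1 / 2) * δ ^ 2 := by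
      rw [← sub_nonneg, show 2 / r * (γc * ψM ^ 2 + 1 / 2) * δ ^ 2 - 2 * γc * ((ψM * δ) ^ 2 / r)
        = δ ^ 2 / r by ring]
      positivity
    nlinarith [mul_le_mul_of_nonneg_left h4 h.D_nonneg, sq_nonneg D]
  · obtain ⟨d, hd, hstep⟩ := h.jump k s (hk.trans_le hcb.2) (hs.trans hcb.1) hj
    have h1 := hB s k hj.1 ⟨h0, hk0⟩ ⟨hs, hk.le⟩
    have h2 := norm_sq_gradient_step_add_le (ψ s (k + 1)) (z s k) d hγd h1 hd
    rw [← hstep] at h2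
    rw [h.dom.jumpTime_eq hj]
    have hψ := h.bound s (k + 1) hj.2 (hs.trans hcb.1) ((Nat.succ_le_of_lt hk).trans hcb.2)
    have h5 := sq_div_le_of_le_add (norm_nonneg _)
      (hmul s k hj.1 ⟨h0, hk0⟩ ⟨hs, hk.le⟩ (ψ s (k + 1))) hr
    set x := ‖mulE (ψ s (k + 1)) v‖
    set q := ‖mulE (ψ s (k + 1)) (z s k)‖
    have hw := specNorm_nonneg (ψ s (k + 1))
    set w := specNorm (ψ s (k + 1))
    set β := 1 / (γd + w ^ 2) with hβ
    have hβ0 : 0 < β := by positivity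
    have hβ1 : β * w ^ 2 ≤ 1 := by
      rw [hβ, one_div_mul_eq_div, div_le_one (by positivity)]
      linarith
    have hmβ : 2 * m ≤ β := by
      have e1 : m ≤ 1 / (2 * (γd + ψM ^ 2)) := min_le_right _ _
      have e2 : 1 / (γd + ψM ^ 2) ≤ β := by rw [hβ]; gcongr
      have e3 : 1 / (2 * (γd + ψM ^ 2)) = 1 / (γd + ψM ^ 2) / 2 := by
        rw [div_div, mul_comm]
      linarith
    have h7 : 2 / (1 + r) * m * x ^ 2 ≤ β * (x ^ 2 / (1 + r)) := by
      rw [show 2 / (1 + r) * m * x ^ 2 = 2 * m * (x ^ 2 / (1 + r)) by ring]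
      gcongr
    have h8 := mul_le_mul_of_nonneg_left h5 hβ0.le
    have h9 : β * ((w * δ) ^ 2 / r) ≤ 2 / r * (γc * ψM ^ 2 + 1 / 2) * δ ^ 2 := by
      have e1 : β * ((w * δ) ^ 2 / r) = (β * w ^ 2) * (δ ^ 2 / r) := by ring
      have e2 : (β * w ^ 2) * (δ ^ 2 / r) ≤ 1 * (δ ^ 2 / r) := by gcongr
      have e3 : 2 / r * (γc * ψM ^ 2 + 1 / 2) * δ ^ 2
          = 1 * (δ ^ 2 / r) + 2 * (γc * ψM ^ 2) * (δ ^ 2 / r) := by ring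
      have e4 : 0 ≤ 2 * (γc * ψM ^ 2) * (δ ^ 2 / r) := by positivity
      linarith
    push_cast
    linarith

end IsPerturbedGradientArc

/-- The scalar step from the loss of `|z|²` over a window to a contraction of `|z|`. -/
theorem le_sqrt_mul_add_of_loss {m x δ E Y σ : ℝ} (hm : 0 ≤ m) (hδ : 0 ≤ δ)
    (hσ : 0 ≤ σ) (hσ1 : σ < 1) (hE : E ≤ 3 * δ ^ 2) (hY : 0 ≤ Y)
    (hYe : Y = m ^ 2 - x ^ 2 + 2 * δ * m + E) (h : √σ * m ≤ √Y + δ) :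
    x ≤ √(1 - σ) * m + 3 / √(1 - σ) * δ := by
  have ht0 : 0 < √(1 - σ) := Real.sqrt_pos.2 (by linarith)
  have ht1 : √(1 - σ) ≤ 1 := Real.sqrt_le_one.2 (by linarith)
  have ht2 : √(1 - σ) ^ 2 = 1 - σ := Real.sq_sqrt (by linarith)
  have hu0 := Real.sqrt_nonneg σ
  have hu1 : √σ ≤ 1 := Real.sqrt_le_one.2 hσ1.le
  have hu2 : √σ ^ 2 = σ := Real.sq_sqrt hσ
  set t := √(1 - σ)
  set u := √σ
  have h3 : 3 * δ ≤ 3 / t * δ := by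
    gcongr
    rw [le_div_iff₀ ht0]
    linarith
  have hY2 := Real.sq_sqrt hY
  rcases le_or_gt δ (u * m) with hc | hc
  · refine le_of_sq_le_sq ?_ (by positivity)
    have e1 : (u * m - δ) ^ 2 ≤ √Y ^ 2 := by
      gcongr
      linarith
    have e2 : t * m * (3 / t * δ) = 3 * m * δ := by field_simp
    have e3 : (3 * δ) ^ 2 ≤ (3 / t * δ) ^ 2 := by gcongr
    have e4 : u * (m * δ) ≤ 1 * (m * δ) := by gcongr
    nlinarith [mul_nonneg hm hδ, sq_nonneg δ]
  · have e1 : x ≤ m + 2 * δ := by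
      refine le_of_sq_le_sq ?_ (by positivity)
      nlinarith [mul_nonneg hm hδ, sq_nonneg δ]
    have e2 : (1 - t) * m ≤ δ := by
      have : (1 - t) ≤ u ^ 2 := by nlinarith
      have e3 : (1 - t) * m ≤ u ^ 2 * m := by gcongr
      have e4 : u * (u * m) ≤ 1 * δ := mul_le_mul hu1 hc.le (by positivity) zero_le_one
      nlinarith
    linarith

/-- An upper bound for the excitation matrix on a window. -/
theorem le_of_excitation_posSemidef {n p : ℕ} {S : Set (ℝ × ℕ)} (hS : IsHybridTimeDomain S)
    {ψ : ℝ → ℕ → Matrix (Fin n) (Fin p) ℝ} {ψM μ : ℝ} {a c : ℝ × ℕ}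
    (hψ : ∀ k s t, Icc s t ⊆ timeSlice S k → ContinuousOn (fun s => ψ s k) (Icc s t))
    (hbound : ∀ s k, (s, k) ∈ S → specNorm (ψ s k) ≤ ψM) (ha : a ∈ S) (hc : c ∈ S) (hac : a ≤ c)
    (hμ : (excitation S ψ a c - μ • (1 : Matrix (Fin p) (Fin p) ℝ)).PosSemidef) (hp : 0 < p) :
    μ ≤ ψM ^ 2 * ((c.1 - a.1) + ((c.2 : ℝ) - a.2)) := by
  set v : EuclideanSpace ℝ (Fin p) := EuclideanSpace.single ⟨0, hp⟩ 1 with hv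
  have hv1 : ‖v‖ = 1 := by simp [hv]
  have hsq : ∀ s k, (s, k) ∈ S → ‖mulE (ψ s k) v‖ ^ 2 ≤ ψM ^ 2 := by
    intro s k hs
    have := norm_mulE_le (ψ s k) v
    rw [hv1, mul_one] at this
    gcongr
    exact this.trans (hbound s k hs)
  have hquad := mul_norm_sq_le_of_posSemidef hμ v
  rw [dotProduct_excitation_mulVec fun k hk i j =>
    integrableOn_gram hS hψ hc (Finset.mem_Icc.1 hk).2 a.1 i j, hv1] at hquad
  have hV : IsHybridArc S fun s k => -(ψM ^ 2) * (s + k) := fun j s t _ _ =>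
    ContDiffOn.absolutelyContinuousOnInterval (by fun_prop)
  have key := hV.le_add_sum_integral hS ha hc hac
    (f := fun s k => -‖mulE (ψ s k) v‖ ^ 2)
    (g := fun k => -‖mulE (ψ (jumpTime S (k + 1)) (k + 1)) v‖ ^ 2)
    (fun k s t hsub => ?_) (fun k _ _ => ?_) fun k s _ _ _ _ hj => ?_
  · simp only [integral_neg, Finset.sum_neg_distrib] at key
    linarith
  · have := hψ k s t hsub
    have : ContinuousOn (fun s => mulE (ψ s k) v) (Icc s t) := by
      unfold mulE
      fun_prop
    fun_prop
  · filter_upwards with s hmem _ _ _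
    have hlin : HasDerivAt (fun r : ℝ => -(ψM ^ 2) * (r + k)) (-(ψM ^ 2)) s := by
      simpa using ((hasDerivAt_id s).add_const (k : ℝ)).const_mul (-(ψM ^ 2))
    rw [hlin.deriv]
    linarith [hsq s k (mem_of_mem_interior_timeSlice hmem)]
  · rw [hS.jumpTime_eq hj]
    have := hsq s (k + 1) hj.2
    push_cast
    linarith

namespace IsPerturbedGradientArc

variable {n p : ℕ} {S : Set (ℝ × ℕ)} {z : ℝ → ℕ → EuclideanSpace ℝ (Fin p)}
  {ψ : ℝ → ℕ → Matrix (Fin n) (Fin p) ℝ} {γc γd ψM D : ℝ} {b : ℝ × ℕ}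

/-- Contraction over an excited window of hybrid length at most `ℓ`. -/
theorem contraction (h : IsPerturbedGradientArc S z ψ γc γd ψM D b) {a c : ℝ × ℕ} (ha : a ∈ S)
    (hc : c ∈ S) (hac : a ≤ c) (hcb : c ≤ b) {ℓ μ K : ℝ}
    (hlen : (c.1 - a.1) + ((c.2 : ℝ) - a.2) ≤ ℓ) (hℓ : 1 ≤ ℓ) (hμ : 0 ≤ μ) (hK : 0 ≤ K)
    (hK1 : 2 * ℓ * (γc * ψM ^ 2 + 1 / 2) ≤ K ^ 2)
    (hK2 : ℓ ^ 2 * (γc * ψM ^ 2 + 1 / 2) * (γc * ψM ^ 2 + 2) ≤ K ^ 2)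
    (hexc : (excitation S ψ a c - μ • (1 : Matrix (Fin p) (Fin p) ℝ)).PosSemidef)
    (hσ : 2 * (min γc (1 / (2 * (γd + ψM ^ 2))) * μ) / (1 + K) ^ 2 < 1) :
    ‖z c.1 c.2‖ ≤ √(1 - 2 * (min γc (1 / (2 * (γd + ψM ^ 2))) * μ) / (1 + K) ^ 2) * ‖z a.1 a.2‖
      + 3 / √(1 - 2 * (min γc (1 / (2 * (γd + ψM ^ 2))) * μ) / (1 + K) ^ 2) * (ℓ * D) := by
  have hγ := h.γc_pos
  have hγd := h.γd_pos
  have hD := h.D_nonneg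
  set μ0 := min γc (1 / (2 * (γd + ψM ^ 2))) * μ with hμ0
  have hμ0' : 0 ≤ μ0 := by positivity
  set m := ‖z a.1 a.2‖ with hm
  have hm0 : 0 ≤ m := norm_nonneg _
  set A := γc * ψM ^ 2 with hA
  have hA0 : 0 ≤ A := by positivity
  set B := m + ℓ * D with hBdef
  set F := 2 * D * B + D ^ 2 with hF
  have hB0 : 0 ≤ B := by positivity
  have hF0 : 0 ≤ F := by positivity
  have hcast : ∀ {i j : ℕ}, i ≤ j → (i : ℝ) ≤ j := fun h => Nat.cast_le.2 h
  have hB : ∀ s k, (s, k) ∈ S → a ≤ (s, k) → (s, k) ≤ c → ‖z s k‖ ≤ B := by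
    intro s k hs h1 h2
    have := h.norm_le ha hs h1 (h2.trans hcb)
    simp only at this
    have h3 : D * ((s - a.1) + ((k : ℝ) - a.2)) ≤ D * ℓ := by
      have := h2.1
      have := hcast h2.2
      simp only at *
      exact mul_le_mul_of_nonneg_left (by linarith) hD
    linarith
  set Y := m ^ 2 - ‖z c.1 c.2‖ ^ 2 + F * ℓ with hY
  have hmid : ∀ s k, (s, k) ∈ S → a ≤ (s, k) → (s, k) ≤ c →
      m ^ 2 - ‖z s k‖ ^ 2 + F * ((s - a.1) + ((k : ℝ) - a.2)) ≤ Y := by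
    intro s k hs h1 h2
    have := h.norm_sq_le hs hc h2 hcb (B := B) fun s' k' hs' e1 e2 => hB s' k' hs' (h1.trans e1) e2
    simp only at this
    have := mul_le_mul_of_nonneg_left hlen hF0
    rw [hY]
    linarith
  have hY0 : 0 ≤ Y := by
    have := hmid a.1 a.2 ha le_rfl hac
    simp only [sub_self, add_zero, mul_zero, ← hm] at this
    exact this
  set δ := 2 * √((A + 2) * Y / 4 * (ℓ / 2)) + ℓ * D with hδdef
  have hδ : ∀ s k, (s, k) ∈ S → a ≤ (s, k) → (s, k) ≤ c → ‖z s k - z a.1 a.2‖ ≤ δ := by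
    intro s k hs h1 h2
    rw [hδdef, ← sub_le_iff_le_add]
    refine le_two_mul_sqrt_of_forall (by positivity) (by positivity) fun e he => ?_
    have h3 := h.excursion_le ha hs h1 (h2.trans hcb) (B := B)
      (fun s' k' hs' e1 e2 => hB s' k' hs' e1 (e2.trans h2)) he
    have h4 := hmid s k hs h1 h2
    simp only [← hA, ← hF, ← hm] at h3
    set L := (s - a.1) + ((k : ℝ) - a.2) with hL
    have hL0 : L ≤ ℓ := by
      have := h2.1
      have := hcast h2.2
      simp only at *
      linarith
    have h5 := mul_le_mul_of_nonneg_left h4 (by positivity : 0 ≤ (A + 2) / (4 * e))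
    have h6 : (e / 2 + D) * L ≤ (e / 2 + D) * ℓ := by gcongr
    have h7 : (A + 2) / (4 * e) * Y = (A + 2) * Y / 4 / e := by
      field_simp
    rw [h7] at h5
    linarith
  have hopt := sqrt_le_of_forall_div (A := 2 * μ0 * m ^ 2) (B := 2 * ℓ * (A + 1 / 2) * δ ^ 2)
    hY0 (by positivity) fun r hr => by
      have h1 := h.norm_sq_le_of_excitation ha hc hac hcb hB hδ hexc hr
      simp only [← hA, ← hF, ← hm, ← hμ0] at h1
      have h2 : (2 / r * (A + 1 / 2) * δ ^ 2 + F) * ((c.1 - a.1) + ((c.2 : ℝ) - a.2)) ≤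
          (2 / r * (A + 1 / 2) * δ ^ 2 + F) * ℓ := by gcongr
      have h3 : 2 * μ0 * m ^ 2 / (1 + r) = 2 / (1 + r) * μ0 * m ^ 2 := by ring
      have h4 : 2 * ℓ * (A + 1 / 2) * δ ^ 2 / r = 2 / r * (A + 1 / 2) * δ ^ 2 * ℓ := by ring
      rw [h3, h4, hY]
      linarith
  have hδ0 : 0 ≤ δ := by positivity
  rw [Real.sqrt_mul (x := 2 * μ0) (by positivity), Real.sqrt_sq hm0,
    Real.sqrt_mul (x := 2 * ℓ * (A + 1 / 2)) (by positivity), Real.sqrt_sq hδ0] at hopt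
  have hG : √(2 * ℓ * (A + 1 / 2)) ≤ K := Real.sqrt_le_iff.2 ⟨hK, hK1⟩
  have hGδ : √(2 * ℓ * (A + 1 / 2)) * (2 * √((A + 2) * Y / 4 * (ℓ / 2))) ≤ K * √Y := by
    refine le_of_sq_le_sq ?_ (by positivity)
    rw [mul_pow, mul_pow, mul_pow, Real.sq_sqrt hY0, Real.sq_sqrt (by positivity),
      Real.sq_sqrt (by positivity)]
    calc _ = ℓ ^ 2 * (A + 1 / 2) * (A + 2) * Y := by ring
      _ ≤ _ := by gcongr
  have hsq : √(2 * μ0) * m ≤ (1 + K) * (√Y + ℓ * D) := by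
    have e1 := mul_le_mul_of_nonneg_right hG (by positivity : 0 ≤ ℓ * D)
    rw [hδdef, mul_add] at hopt
    nlinarith [Real.sqrt_nonneg Y, (by positivity : 0 ≤ ℓ * D)]
  refine le_sqrt_mul_add_of_loss (E := 2 * (ℓ * D) ^ 2 + ℓ * D ^ 2) (Y := Y) hm0 (by positivity)
    (by positivity) hσ ?_ hY0 ?_ ?_
  · have : ℓ * D ^ 2 ≤ ℓ * ℓ * D ^ 2 := by
      gcongr
      nlinarith
    linarith
  · rw [hY, hF, hBdef]
    ring
  · rw [Real.sqrt_div (by positivity), Real.sqrt_sq (by positivity), div_mul_eq_mul_div,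
      div_le_iff₀ (by positivity)]
    linarith

/-- Exponential decay in hybrid time from contraction over windows. -/
theorem norm_le_exp (h : IsPerturbedGradientArc S z ψ γc γd ψM D b) {Δ lam C₀ C : ℝ}
    (hΔ : 0 < Δ) (hlam : 0 ≤ lam)
    (hwin : ∀ a ∈ S, ∀ c ∈ S, a ≤ c → c ≤ b → IsWindow Δ a c →
      ‖z c.1 c.2‖ ≤ Real.exp (-lam * (Δ + 1)) * ‖z a.1 a.2‖ + C₀ * D)
    (hC₀ : C₀ ≤ (1 - Real.exp (-lam * (Δ + 1))) * C) (hC : Δ ≤ C) {c : ℝ × ℕ} (hc : c ∈ S)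
    (hcb : c ≤ b) :
    ‖z c.1 c.2‖ ≤ Real.exp (lam * (Δ + 1)) * Real.exp (-lam * (c.1 + c.2)) * ‖z 0 0‖ + C * D := by
  have hD := h.D_nonneg
  obtain ⟨N, hN⟩ := exists_nat_gt ((c.1 + c.2) / Δ)
  rw [div_lt_iff₀ hΔ] at hN
  induction N generalizing c with
  | zero =>
    have h1 : 0 ≤ c.1 := h.dom.fst_nonneg (k := c.2) hc
    have h2 : (0 : ℝ) ≤ c.2 := Nat.cast_nonneg _
    simp only [Nat.cast_zero, zero_mul] at hN
    linarith
  | succ N ih =>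
    have hc1 : 0 ≤ c.1 := h.dom.fst_nonneg (k := c.2) hc
    rcases lt_or_ge (c.1 + c.2) Δ with hlt | hge
    · have h1 := h.norm_le h.dom.zero_mem hc ⟨hc1, Nat.zero_le _⟩ hcb
      simp only [sub_zero, Nat.cast_zero] at h1
      have h2 : D * (c.1 + c.2) ≤ D * C := by
        gcongr
        linarith
      have h3 : 1 ≤ Real.exp (lam * (Δ + 1)) * Real.exp (-lam * (c.1 + c.2)) := by
        rw [← Real.exp_add, Real.one_le_exp_iff]
        nlinarith
      nlinarith [norm_nonneg (z 0 0)]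
    · obtain ⟨a, ha, hac, h1, h2⟩ := h.dom.exists_mem_level hc (c := c.1 + c.2 - Δ)
        (by linarith) (by linarith)
      have hw := hwin a ha c hc hac hcb ⟨by linarith, by linarith⟩
      have hia := ih ha (hac.trans hcb) (by push_cast at hN; linarith)
      have h3 := mul_le_mul_of_nonneg_left hia (Real.exp_pos (-lam * (Δ + 1))).le
      have h4 : Real.exp (-lam * (Δ + 1)) *
          (Real.exp (lam * (Δ + 1)) * Real.exp (-lam * (a.1 + a.2)) * ‖z 0 0‖) ≤
          Real.exp (lam * (Δ + 1)) * Real.exp (-lam * (c.1 + c.2)) * ‖z 0 0‖ := by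
        rw [← mul_assoc]
        refine mul_le_mul_of_nonneg_right ?_ (norm_nonneg _)
        rw [← Real.exp_add, ← Real.exp_add, ← Real.exp_add, Real.exp_le_exp]
        nlinarith
      nlinarith [mul_le_mul_of_nonneg_right hC₀ hD]

end IsPerturbedGradientArc

/-! ### The supremum norm of hybrid signals -/

section hybridSupNorm

variable {V V' : Type*} [NormedAddCommGroup V] [NormedAddCommGroup V'] {S : Set (ℝ × ℕ)}
  {f : ℝ → ℕ → V} {t : ℝ} {j : ℕ}

theorem norm_le_hybridSupNorm_of_jump (h : hybridSupNorm S f t j ≠ ∞) {s : ℝ} {k : ℕ}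
    (hs : (s, k) ∈ jumpPoints S) (hst : s ≤ t) (hkj : k ≤ j) :
    ‖f s k‖ ≤ (hybridSupNorm S f t j).toReal := by
  have h1 : ‖f s k‖ₑ ≤ hybridSupNorm S f t j := by
    refine le_trans ?_ (le_max_right _ _)
    exact le_iSup₂_of_le (f := fun (q : ℝ × ℕ) (_ : q ∈ {q : ℝ × ℕ | q ∈ jumpPoints S ∧ q.1 ≤ t ∧
      q.2 ≤ j}) => ‖f q.1 q.2‖ₑ) (s, k) ⟨hs, hst, hkj⟩ le_rfl
  simpa using ENNReal.toReal_mono h h1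

theorem ae_norm_le_hybridSupNorm (hS : IsHybridTimeDomain S) (h : hybridSupNorm S f t j ≠ ∞)
    {k : ℕ} (hkj : k ≤ j) :
    ∀ᵐ s, (s, k) ∈ S → s ≤ t →
      (s, k) ∉ jumpPoints S ∧ ‖f s k‖ ≤ (hybridSupNorm S f t j).toReal := by
  have h1 : essSup (fun s => ‖f s k‖ₑ)
      (volume.restrict {s | (s, k) ∈ S \ jumpPoints S ∧ s ≤ t}) ≤ hybridSupNorm S f t j := by
    refine le_trans ?_ (le_max_left _ _)
    exact le_iSup₂_of_le (f := fun (k : ℕ) (_ : k ∈ Iic j) => essSup (fun s => ‖f s k‖ₑ)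
      (volume.restrict {s | (s, k) ∈ S \ jumpPoints S ∧ s ≤ t})) k hkj le_rfl
  have h2 := ae_imp_of_ae_restrict (ae_le_essSup (μ := volume.restrict
    {s | (s, k) ∈ S \ jumpPoints S ∧ s ≤ t}) (f := fun s => ‖f s k‖ₑ))
  filter_upwards [h2, hS.ae_notMem_jumpPoints k] with s hs hj hmem hst
  refine ⟨hj, ?_⟩
  simpa using ENNReal.toReal_mono h ((hs ⟨⟨hmem, hj⟩, hst⟩).trans h1)

theorem hybridSupNorm_le_const_mul {g : ℝ → ℕ → V'} {c : ℝ} (hc : 0 ≤ c)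
    (h : ∀ s k, ‖f s k‖ ≤ c * ‖g s k‖) :
    hybridSupNorm S f t j ≤ ENNReal.ofReal c * hybridSupNorm S g t j := by
  have h' : ∀ s k, ‖f s k‖ₑ ≤ ENNReal.ofReal c * ‖g s k‖ₑ := fun s k => by
    rw [← ofReal_norm, ← ofReal_norm, ← ENNReal.ofReal_mul hc]
    exact ENNReal.ofReal_le_ofReal (h s k)
  refine max_le (iSup₂_le fun k hk => ?_) (iSup₂_le fun q hq => ?_)
  · refine (essSup_mono_ae (Filter.Eventually.of_forall fun s => h' s k)).trans ?_
    rw [ENNReal.essSup_const_mul]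
    refine mul_le_mul_right (le_trans ?_ (le_max_left _ _)) _
    exact le_iSup₂_of_le (f := fun (k : ℕ) (_ : k ∈ Iic j) => essSup (fun s => ‖g s k‖ₑ)
      (volume.restrict {s | (s, k) ∈ S \ jumpPoints S ∧ s ≤ t})) k hk le_rfl
  · refine (h' _ _).trans (mul_le_mul_right (le_trans ?_ (le_max_right _ _)) _)
    exact le_iSup₂_of_le (f := fun (q : ℝ × ℕ) (_ : q ∈ {q : ℝ × ℕ | q ∈ jumpPoints S ∧ q.1 ≤ t ∧
      q.2 ≤ j}) => ‖g q.1 q.2‖ₑ) q hq le_rfl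

end hybridSupNorm

/-! ### Components of the state -/

namespace EstState

variable {n p : ℕ}

section mk

variable (x eta : EuclideanSpace ℝ (Fin n)) (th : EuclideanSpace ℝ (Fin p))
  (psi : Matrix (Fin n) (Fin p) ℝ) (tau k : ℝ)

@[simp] theorem x_mk : (mk x th psi eta tau k).x = x := rfl
@[simp] theorem th_mk : (mk x th psi eta tau k).th = th := rfl
@[simp] theorem psi_mk : (mk x th psi eta tau k).psi = psi := rfl
@[simp] theorem eta_mk : (mk x th psi eta tau k).eta = eta := rfl
@[simp] theorem tau_mk : (mk x th psi eta tau k).tau = tau := rfl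
@[simp] theorem kReal_mk : (mk x th psi eta tau k).kReal = k := rfl
@[simp] theorem k_mk : (mk x th psi eta tau k).k = ⌊k⌋₊ := rfl

end mk

theorem norm_sq_eq (ξ : EstState n p) :
    ‖ξ‖ ^ 2 = ‖ξ.x‖ ^ 2 + ‖ξ.th‖ ^ 2 + frobNorm ξ.psi ^ 2 + ‖ξ.eta‖ ^ 2 + ξ.tau ^ 2
      + ξ.kReal ^ 2 := by
  rw [frobNorm_sq, ← Fintype.sum_prod_type' (f := fun i j => ξ.psi i j ^ 2)]
  simp only [EuclideanSpace.norm_sq_eq, Fintype.sum_sum_type, Real.norm_eq_abs, sq_abs]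
  simp [x, th, psi, eta, tau, kReal]
  ring

@[simp] theorem x_sub (ξ ζ : EstState n p) : (ξ - ζ).x = ξ.x - ζ.x := rfl
@[simp] theorem th_sub (ξ ζ : EstState n p) : (ξ - ζ).th = ξ.th - ζ.th := rfl
@[simp] theorem psi_sub (ξ ζ : EstState n p) : (ξ - ζ).psi = ξ.psi - ζ.psi := rfl
@[simp] theorem eta_sub (ξ ζ : EstState n p) : (ξ - ζ).eta = ξ.eta - ζ.eta := rfl
@[simp] theorem tau_sub (ξ ζ : EstState n p) : (ξ - ζ).tau = ξ.tau - ζ.tau := rfl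
@[simp] theorem kReal_sub (ξ ζ : EstState n p) : (ξ - ζ).kReal = ξ.kReal - ζ.kReal := rfl

/-- The component `θ̂` as a continuous linear map. -/
noncomputable def thL : EstState n p →L[ℝ] EuclideanSpace ℝ (Fin p) :=
  LinearMap.toContinuousLinearMap
    { toFun := th, map_add' := fun _ _ => rfl, map_smul' := fun _ _ => rfl }

/-- The component `ψ` as a Euclidean vector. -/
noncomputable def psiL : EstState n p →L[ℝ] EuclideanSpace ℝ (Fin n × Fin p) :=
  LinearMap.toContinuousLinearMap
    { toFun := fun ξ => WithLp.toLp 2 fun q => ξ.psi q.1 q.2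
      map_add' := fun _ _ => rfl
      map_smul' := fun _ _ => rfl }

theorem norm_psiL (ξ : EstState n p) : ‖psiL ξ‖ = frobNorm ξ.psi :=
  (frobNorm_eq ξ.psi).symm

end EstState

namespace EstData

variable {n p m : ℕ} (W : EstData n p m)

/-- The component `ε` as a continuous linear map. -/
noncomputable def epsL : EstState n p →L[ℝ] EuclideanSpace ℝ (Fin n) :=
  LinearMap.toContinuousLinearMap
    { toFun := W.eps
      map_add' := fun ξ ζ => by
        change (ξ.x + ζ.x) + (ξ.eta + ζ.eta) - mulE (ξ.psi + ζ.psi) W.theta = _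
        rw [add_mulE, eps, eps]
        abel
      map_smul' := fun c ξ => by
        change c • ξ.x + c • ξ.eta - mulE (c • ξ.psi) W.theta = c • W.eps ξ
        rw [smul_mulE, eps, smul_sub, smul_add] }

theorem epsL_apply (ξ : EstState n p) : W.epsL ξ = W.eps ξ := rfl

/-! ### The distance to the target set -/

/-- The nearest point of the target set. -/
noncomputable def proj (ξ : EstState n p) : EstState n p :=
  let c := 1 / (2 + ‖W.theta‖ ^ 2)
  EstState.mk (ξ.x - c • W.eps ξ) W.theta
    (ξ.psi + Matrix.of fun i a => c * (W.eps ξ) i * W.theta a) (ξ.eta - c • W.eps ξ) ξ.tau ξ.kReal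

theorem proj_mem_target {ξ : EstState n p} (hξ : ξ ∈ W.stateSet) : W.proj ξ ∈ W.target := by
  refine ⟨hξ, rfl, ?_⟩
  have hc : (2 + ‖W.theta‖ ^ 2) ≠ 0 := by positivity
  have h1 : mulE (Matrix.of fun i a => 1 / (2 + ‖W.theta‖ ^ 2) * (W.eps ξ) i * W.theta a) W.theta
      = (1 / (2 + ‖W.theta‖ ^ 2) * ‖W.theta‖ ^ 2) • W.eps ξ := by
    ext i
    simp only [mulE, Matrix.mulVec, dotProduct, Matrix.of_apply, PiLp.smul_apply, smul_eq_mul,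
      EuclideanSpace.norm_sq_eq, Real.norm_eq_abs, sq_abs, mul_assoc, ← Finset.mul_sum]
    simp only [Finset.mul_sum, Finset.sum_mul]
    exact Finset.sum_congr rfl fun a _ => by ring
  have h2 : W.eps (W.proj ξ) = W.eps ξ - (2 * (1 / (2 + ‖W.theta‖ ^ 2))) • W.eps ξ
      - (1 / (2 + ‖W.theta‖ ^ 2) * ‖W.theta‖ ^ 2) • W.eps ξ := by
    rw [← h1]
    conv_lhs => rw [eps]
    simp only [proj, EstState.x_mk, EstState.eta_mk, EstState.psi_mk, add_mulE]
    conv_rhs => enter [1, 1]; rw [eps]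
    module
  have h3 : W.eps ξ - (2 * (1 / (2 + ‖W.theta‖ ^ 2))) • W.eps ξ
      - (1 / (2 + ‖W.theta‖ ^ 2) * ‖W.theta‖ ^ 2) • W.eps ξ
      = (1 - 1 / (2 + ‖W.theta‖ ^ 2) * (2 + ‖W.theta‖ ^ 2)) • W.eps ξ := by
    module
  rw [h2, h3, one_div_mul_cancel hc, sub_self, zero_smul]

theorem infDist_target {ξ : EstState n p} (hξ : ξ ∈ W.stateSet) :
    Metric.infDist ξ W.target = √(‖W.theta - ξ.th‖ ^ 2 + ‖W.eps ξ‖ ^ 2 / (2 + ‖W.theta‖ ^ 2)) := by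
  refine le_antisymm ?_ ?_
  · refine (Metric.infDist_le_dist_of_mem (W.proj_mem_target hξ)).trans ?_
    rw [dist_eq_norm]
    refine Real.le_sqrt_of_sq_le (le_of_eq ?_)
    rw [EstState.norm_sq_eq]
    simp only [EstState.x_sub, EstState.th_sub, EstState.psi_sub, EstState.eta_sub,
      EstState.tau_sub, EstState.kReal_sub, proj, EstState.x_mk, EstState.eta_mk, EstState.psi_mk,
      EstState.th_mk, EstState.tau_mk, EstState.kReal_mk, sub_self, sub_sub_cancel, norm_smul]
    rw [frobNorm_sq, norm_sub_rev ξ.th, Real.norm_of_nonneg (by positivity)]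
    have h1 : ∑ i, ∑ j, (ξ.psi - (ξ.psi + Matrix.of fun (i : Fin n) (a : Fin p) =>
        1 / (2 + ‖W.theta‖ ^ 2) * (W.eps ξ) i * W.theta a) : Matrix (Fin n) (Fin p) ℝ) i j ^ 2
        = (1 / (2 + ‖W.theta‖ ^ 2)) ^ 2 * (‖W.eps ξ‖ ^ 2 * ‖W.theta‖ ^ 2) := by
      rw [EuclideanSpace.norm_sq_eq (W.eps ξ), EuclideanSpace.norm_sq_eq W.theta,
        Finset.sum_mul_sum, Finset.mul_sum]
      refine Finset.sum_congr rfl fun i _ => ?_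
      rw [Finset.mul_sum]
      refine Finset.sum_congr rfl fun a _ => ?_
      simp only [sub_add_cancel_left, Matrix.neg_apply, Matrix.of_apply, Real.norm_eq_abs, sq_abs]
      ring
    rw [h1]
    field_simp
    ring
  · refine (Metric.le_infDist ⟨_, W.proj_mem_target hξ⟩).2 fun ζ hζ => ?_
    rw [dist_eq_norm]
    refine Real.sqrt_le_iff.2 ⟨norm_nonneg _, ?_⟩
    rw [EstState.norm_sq_eq]
    have hth : ‖(ξ - ζ).th‖ = ‖W.theta - ξ.th‖ := by
      rw [EstState.th_sub, hζ.2.1, norm_sub_rev]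
    have heps : W.eps (ξ - ζ) = W.eps ξ := by
      rw [← epsL_apply, map_sub, epsL_apply, epsL_apply, hζ.2.2, sub_zero]
    rw [hth, ← heps]
    set ω := ξ - ζ
    have h1 : ‖W.eps ω‖ ≤ ‖ω.x‖ + ‖ω.eta‖ + frobNorm ω.psi * ‖W.theta‖ :=
      (norm_sub_le _ _).trans (add_le_add (norm_add_le _ _) (norm_mulE_le_frobNorm _ _))
    have h2 : ‖W.eps ω‖ ^ 2 / (2 + ‖W.theta‖ ^ 2) ≤
        ‖ω.x‖ ^ 2 + ‖ω.eta‖ ^ 2 + frobNorm ω.psi ^ 2 := by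
      rw [div_le_iff₀ (by positivity)]
      refine (pow_le_pow_left₀ (norm_nonneg _) h1 2).trans ?_
      nlinarith [sq_nonneg (‖ω.x‖ - ‖ω.eta‖), sq_nonneg (‖ω.x‖ * ‖W.theta‖ - frobNorm ω.psi),
        sq_nonneg (‖ω.eta‖ * ‖W.theta‖ - frobNorm ω.psi)]
    nlinarith [sq_nonneg ω.tau, sq_nonneg ω.kReal]

end EstData

/-! ### The constants -/

theorem one_sub_abs_one_sub_ge {l : ℝ} (hl : l ∈ Ioo (0 : ℝ) 2) :
    l * (2 - l) / 2 ≤ 1 - |1 - l| := by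
  obtain ⟨h0, h2⟩ := hl
  have h1 : |1 - l| ≤ 1 := abs_le.2 ⟨by linarith, by linarith⟩
  nlinarith [sq_abs (1 - l), abs_nonneg (1 - l)]

/-- `|1 - λ_d|` is at most the decay per jump of the form used for `λ_ε`. -/
theorem abs_one_sub_le_exp {l z e : ℝ} (hl : l ∈ Ioo (0 : ℝ) 2) (hz : z ∈ Ioo (0 : ℝ) 1)
    (he : e ≤ 1 / 2 * -Real.log (1 - l / 2 * (2 - l) * (1 - z))) :
    |1 - l| ≤ Real.exp (-e) := by
  obtain ⟨h0, h2⟩ := hl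
  have hc : 0 < l * (2 - l) := mul_pos h0 (by linarith)
  have hc1 : l * (2 - l) ≤ 1 := by nlinarith [sq_nonneg (1 - l)]
  have hpos : 0 < 1 - l / 2 * (2 - l) * (1 - z) := by nlinarith [hz.1, hz.2]
  have h3 : Real.exp (1 / 2 * Real.log (1 - l / 2 * (2 - l) * (1 - z))) ≤ Real.exp (-e) :=
    Real.exp_le_exp.2 (by linarith)
  refine le_trans (abs_le_of_sq_le_sq ?_ (Real.exp_pos _).le) h3
  rw [← Real.exp_nat_mul, Nat.cast_ofNat, ← mul_assoc, mul_one_div_cancel two_ne_zero, one_mul,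
    Real.exp_log hpos]
  nlinarith [hz.1, hz.2]

namespace EstParams

variable {P : EstParams}

/-- The square root in the definition of `σ`. -/
noncomputable def rootK (P : EstParams) : ℝ :=
  √((P.aM + 2) * (P.Delta + 2) ^ 3 * (P.aM * (P.Delta + 2) + 1 / 2))

theorem sigma_eq : P.sigma = 2 * P.mu0 / (1 + P.rootK) ^ 2 := rfl

theorem rootK_nonneg : 0 ≤ P.rootK := Real.sqrt_nonneg _

namespace Admissible

theorem lamd_mul_pos (hP : P.Admissible) : 0 < P.lamd * (2 - P.lamd) :=
  mul_pos hP.lamd_mem.1 (by linarith [hP.lamd_mem.2])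

theorem four_div_le (hP : P.Admissible) : 4 / (P.lamd * (2 - P.lamd)) ≤
    √(2 * P.lamd * (2 - P.lamd) + 16) / (P.lamd * (2 - P.lamd)) := by
  have := hP.lamd_mul_pos
  gcongr
  exact Real.le_sqrt_of_sq_le (by nlinarith)

theorem psiM_pos (hP : P.Admissible) : 0 < P.psiM := by
  have := hP.psi0_nonneg
  have := hP.phiM_pos
  have := hP.lamc_pos
  unfold psiM
  positivity

theorem aM_pos (hP : P.Admissible) : 0 < P.aM := by
  have := hP.psiM_pos
  have := hP.gamc_pos
  unfold aM
  positivity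

theorem mu0_pos (hP : P.Admissible) : 0 < P.mu0 := by
  have := hP.gamc_pos
  have := hP.gamd_pos
  have := hP.mu_pos
  unfold mu0
  positivity

theorem rootK_sq (hP : P.Admissible) :
    P.rootK ^ 2 = (P.aM + 2) * (P.Delta + 2) ^ 3 * (P.aM * (P.Delta + 2) + 1 / 2) := by
  have := hP.aM_pos
  have := hP.Delta_pos
  exact Real.sq_sqrt (by positivity)

theorem rootK_sq_ge (hP : P.Admissible) : 2 * (P.Delta + 1) * (P.aM + 1 / 2) ≤ P.rootK ^ 2 := by
  have ha := hP.aM_pos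
  have hd := hP.Delta_pos
  rw [hP.rootK_sq]
  have h1 : P.Delta + 1 ≤ (P.Delta + 2) ^ 3 := by
    have : (P.Delta + 2) ^ 1 ≤ (P.Delta + 2) ^ 3 :=
      pow_le_pow_right₀ (by linarith) (by norm_num)
    linarith
  have h2 : P.aM + 1 / 2 ≤ P.aM * (P.Delta + 2) + 1 / 2 := by nlinarith
  gcongr
  linarith

theorem rootK_sq_ge' (hP : P.Admissible)
    : (P.Delta + 1) ^ 2 * (P.aM + 1 / 2) * (P.aM + 2) ≤ P.rootK ^ 2 := by
  have ha := hP.aM_pos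
  have hd := hP.Delta_pos
  rw [hP.rootK_sq]
  have h1 : (P.Delta + 1) ^ 2 ≤ (P.Delta + 2) ^ 3 := by
    calc (P.Delta + 1) ^ 2 ≤ (P.Delta + 2) ^ 2 := by gcongr; linarith
      _ ≤ (P.Delta + 2) ^ 3 := pow_le_pow_right₀ (by linarith) (by norm_num)
  have h2 : P.aM + 1 / 2 ≤ P.aM * (P.Delta + 2) + 1 / 2 := by nlinarith
  calc _ = (P.aM + 2) * (P.Delta + 1) ^ 2 * (P.aM + 1 / 2) := by ring
    _ ≤ _ := by gcongr

theorem sigma_pos (hP : P.Admissible) : 0 < P.sigma := by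
  have := hP.mu0_pos
  have := P.rootK_nonneg
  rw [sigma_eq]
  positivity

theorem sigma_lt_one_of_mu_le (hP : P.Admissible)
    (h : P.mu ≤ P.psiM ^ 2 * (P.Delta + 1)) : P.sigma < 1 := by
  have hK := P.rootK_nonneg
  have hd := hP.Delta_pos
  have hμ : P.mu0 ≤ P.aM * (P.Delta + 1) := by
    calc P.mu0 ≤ P.gamc * P.mu := mul_le_mul_of_nonneg_right (min_le_left _ _) hP.mu_pos.le
      _ ≤ P.gamc * (P.psiM ^ 2 * (P.Delta + 1)) := mul_le_mul_of_nonneg_left h hP.gamc_pos.le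
      _ = _ := by rw [aM]; ring
  rw [sigma_eq, div_lt_one (by positivity)]
  have := hP.rootK_sq_ge
  nlinarith

theorem lam0_pos (hP : P.Admissible) (hσ : P.sigma < 1) : 0 < P.lam0 := by
  have := hP.Delta_pos
  have := Real.log_neg (x := 1 - P.sigma) (by linarith) (by linarith [hP.sigma_pos])
  unfold lam0
  exact div_pos (by linarith) (by linarith)

theorem sqrt_one_sub_sigma (hP : P.Admissible) (hσ : P.sigma < 1)
    : √(1 - P.sigma) = Real.exp (-P.lam0 * (P.Delta + 1)) := by
  have := hP.Delta_pos
  rw [lam0, show -(-Real.log (1 - P.sigma) / (2 * (P.Delta + 1))) * (P.Delta + 1)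
    = Real.log (1 - P.sigma) / 2 by field_simp, Real.exp_half, Real.exp_log (by linarith)]

theorem kappa0_eq (hP : P.Admissible) (hσ : P.sigma < 1)
    : P.kappa0 = Real.exp (P.lam0 * (P.Delta + 1)) := by
  rw [kappa0, one_div, Real.sqrt_inv, hP.sqrt_one_sub_sigma hσ, ← Real.exp_neg]
  ring_nf

theorem one_le_kappa0 (hP : P.Admissible) (hσ : P.sigma < 1) : 1 ≤ P.kappa0 := by
  rw [hP.kappa0_eq hσ, Real.one_le_exp_iff]
  have := hP.lam0_pos hσ
  have := hP.Delta_pos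
  positivity

theorem pM_ge (hP : P.Admissible) (hσ : P.sigma < 1)
    : P.qm + P.qm * P.kappa0 ^ 2 / (2 * P.lam0) + P.qm * P.kappa0 ^ 2 * max 1
    (1 / (2 * P.lam0)) ≤ P.pM := by
  have hl := hP.lam0_pos hσ
  have hk := hP.one_le_kappa0 hσ
  have hq := hP.qm_pos
  have hqq := hP.qm_le_qM
  have he : 0 < Real.exp (2 * P.lam0) - 1 := by
    have := Real.add_one_lt_exp (x := 2 * P.lam0) (by positivity)
    linarith
  have h1 : max 1 (1 / (2 * P.lam0)) ≤ Real.exp (2 * P.lam0) / (Real.exp (2 * P.lam0) - 1) := by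
    refine max_le ?_ ?_
    · rw [le_div_iff₀ he]
      linarith
    · rw [div_le_div_iff₀ (by positivity) he]
      have h2 := Real.add_one_le_exp (-(2 * P.lam0))
      have h3 : Real.exp (-(2 * P.lam0)) * Real.exp (2 * P.lam0) = 1 := by
        rw [← Real.exp_add]
        simp
      nlinarith [Real.exp_pos (2 * P.lam0)]
  have hqM : 0 ≤ P.qM := hq.le.trans hqq
  rw [pM, mul_div_assoc (P.qM * P.kappa0 ^ 2)]
  gcongr

theorem qm_le_pM (hP : P.Admissible) (hσ : P.sigma < 1) : P.qm ≤ P.pM := by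
  have hl := hP.lam0_pos hσ
  have hq := hP.qm_pos
  have h1 : 0 ≤ P.qm * P.kappa0 ^ 2 / (2 * P.lam0) := by positivity
  have h2 : 0 ≤ P.qm * P.kappa0 ^ 2 * max 1 (1 / (2 * P.lam0)) := by positivity
  linarith [hP.pM_ge hσ]

theorem pM_pos (hP : P.Admissible) (hσ : P.sigma < 1)
    : 0 < P.pM := hP.qm_pos.trans_le (hP.qm_le_pM hσ)

theorem kappa0_sq_le (hP : P.Admissible) (hσ : P.sigma < 1) : P.qm * P.kappa0 ^ 2 ≤ P.pM := by
  have hl := hP.lam0_pos hσ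
  have hq := hP.qm_pos
  have h1 : 0 ≤ P.qm * P.kappa0 ^ 2 / (2 * P.lam0) := by positivity
  have h2 : P.qm * P.kappa0 ^ 2 * 1 ≤ P.qm * P.kappa0 ^ 2 * max 1 (1 / (2 * P.lam0)) := by
    gcongr
    exact le_max_left _ _
  linarith [hP.pM_ge hσ]

theorem kappa0_sq_div_le (hP : P.Admissible) (hσ : P.sigma < 1)
    : P.kappa0 ^ 2 / P.lam0 ≤ P.pM / P.qm := by
  have hl := hP.lam0_pos hσ
  have hq := hP.qm_pos
  have h2 : P.qm * P.kappa0 ^ 2 * (1 / (2 * P.lam0)) ≤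
      P.qm * P.kappa0 ^ 2 * max 1 (1 / (2 * P.lam0)) := by
    gcongr
    exact le_max_right _ _
  rw [le_div_iff₀ hq]
  have h3 : P.kappa0 ^ 2 / P.lam0 * P.qm = P.qm * P.kappa0 ^ 2 / (2 * P.lam0)
      + P.qm * P.kappa0 ^ 2 * (1 / (2 * P.lam0)) := by
    field_simp
    ring
  linarith [hP.pM_ge hσ]

theorem kappaNu_pos (hP : P.Admissible) (hσ : P.sigma < 1) : 0 < P.kappaNu := by
  have := hP.pM_pos hσ
  have := hP.qm_pos
  unfold kappaNu pm
  positivity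

theorem kappa0_le_kappaNu (hP : P.Admissible) (hσ : P.sigma < 1) : P.kappa0 ≤ P.kappaNu := by
  have hq := hP.qm_pos
  have hp := hP.pM_pos hσ
  refine Real.le_sqrt_of_sq_le ?_
  rw [pm, le_div_iff₀ hq]
  linarith [hP.kappa0_sq_le hσ]

theorem omega_arg_mem (hP : P.Admissible) (hσ : P.sigma < 1)
    : P.qm / (2 * P.pM) * (1 - P.zeta) ∈ Ioo (0 : ℝ) 1 := by
  have hq := hP.qm_pos
  have hp := hP.pM_pos hσ
  have hz := hP.zeta_mem
  have h1 : P.qm / (2 * P.pM) ≤ 1 / 2 := by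
    rw [div_le_div_iff₀ (by positivity) (by positivity)]
    linarith [hP.qm_le_pM hσ]
  have h0 : 0 < P.qm / (2 * P.pM) := by positivity
  exact ⟨mul_pos h0 (by linarith [hz.2]), by nlinarith [hz.1, hz.2]⟩

theorem omega_pos (hP : P.Admissible) (hσ : P.sigma < 1) : 0 < P.omega := by
  obtain ⟨h0, h1⟩ := hP.omega_arg_mem hσ
  have := Real.log_neg (x := 1 - P.qm / (2 * P.pM) * (1 - P.zeta)) (by linarith) (by linarith)
  exact mul_pos (by norm_num) (lt_min h0 (by linarith))

theorem omega_le_lam0 (hP : P.Admissible) (hσ : P.sigma < 1) : P.omega ≤ P.lam0 := by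
  have hl := hP.lam0_pos hσ
  have hq := hP.qm_pos
  have hp := hP.pM_pos hσ
  have hz := hP.zeta_mem
  have hk := hP.one_le_kappa0 hσ
  have h1 : P.omega ≤ 1 / 2 * (P.qm / (2 * P.pM) * (1 - P.zeta)) :=
    mul_le_mul_of_nonneg_left (min_le_left _ _) (by norm_num)
  have h0 : 0 < P.qm / (2 * P.pM) := by positivity
  have h2 : P.qm / (2 * P.pM) ≤ P.lam0 := by
    rw [div_le_iff₀ (by positivity)]
    have h3 := hP.kappa0_sq_div_le hσ
    rw [div_le_div_iff₀ hl hq] at h3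
    have : P.qm * 1 ≤ P.qm * P.kappa0 ^ 2 := by
      gcongr
      nlinarith
    nlinarith
  nlinarith [hz.1, hz.2]

theorem three_mul_le_rho (hP : P.Admissible) (hσ : P.sigma < 1)
    : 3 * (P.pM / P.qm) ≤ √2 * P.rho := by
  have hq := hP.qm_pos
  have hp := hP.pM_pos hσ
  have hz := hP.zeta_mem
  have hz0 := hz.1
  have hr : 1 ≤ P.pM / P.qm := (one_le_div hq).2 (hP.qm_le_pM hσ)
  rw [rho, ← Real.sqrt_mul zero_le_two]
  refine Real.le_sqrt_of_sq_le ?_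
  have e : 2 * (2 * P.pM ^ 2 / (P.qm * P.pm * P.zeta) * (2 * P.pM / P.qm + 1))
      = 4 * (P.pM / P.qm) ^ 2 * (2 * (P.pM / P.qm) + 1) / P.zeta := by
    rw [pm]
    field_simp
    ring
  rw [e, le_div_iff₀ hz0]
  set x := P.pM / P.qm
  have h1 : (3 * x) ^ 2 * P.zeta ≤ (3 * x) ^ 2 * 1 := by
    gcongr
    exact hz.2.le
  nlinarith [sq_nonneg x]

theorem rho_pos (hP : P.Admissible) (hσ : P.sigma < 1) : 0 < P.rho := by
  have hq := hP.qm_pos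
  have hp := hP.pM_pos hσ
  have hz := hP.zeta_mem.1
  unfold rho pm
  positivity

theorem lamEps_pos (hP : P.Admissible) : 0 < P.lamEps := by
  have hc := hP.lamd_mul_pos
  have hz := hP.zeta_mem
  have hc1 : P.lamd * (2 - P.lamd) ≤ 1 := by nlinarith [sq_nonneg (1 - P.lamd)]
  have h0 : 0 < P.lamd / 2 * (2 - P.lamd) * (1 - P.zeta) := by
    have : 0 < P.lamd * (2 - P.lamd) * (1 - P.zeta) := mul_pos hc (by linarith [hz.2])
    linarith
  have h1 : P.lamd / 2 * (2 - P.lamd) * (1 - P.zeta) < 1 := by nlinarith [hz.1, hz.2]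
  have := Real.log_neg (x := 1 - P.lamd / 2 * (2 - P.lamd) * (1 - P.zeta)) (by linarith)
    (by linarith)
  exact mul_pos (by norm_num)
    (lt_min (mul_pos hP.lamc_pos (by linarith [hz.2])) (by linarith))

theorem lamNu_pos (hP : P.Admissible) (hσ : P.sigma < 1)
    : 0 < P.lamNu := lt_min (hP.omega_pos hσ) hP.lamEps_pos

theorem rhoNu_pos (hP : P.Admissible) (hσ : P.sigma < 1) : 0 < P.rhoNu :=
  mul_pos (by positivity) ((hP.rho_pos hσ).trans_le (le_max_left _ _))

theorem lamEps_le_lamc (hP : P.Admissible) : P.lamEps ≤ P.lamc := by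
  have hz := hP.zeta_mem
  have := hP.lamc_pos
  have h1 : P.lamEps ≤ 1 / 2 * (P.lamc * (1 - P.zeta)) :=
    mul_le_mul_of_nonneg_left (min_le_left _ _) (by norm_num)
  nlinarith [hz.1, hz.2]

theorem abs_one_sub_lamd_le (hP : P.Admissible) : |1 - P.lamd| ≤ Real.exp (-P.lamEps) :=
  abs_one_sub_le_exp hP.lamd_mem hP.zeta_mem
    (mul_le_mul_of_nonneg_left (min_le_right _ _) (by norm_num))

theorem sqrt_zeta_le_one (hP : P.Admissible) : √P.zeta ≤ 1 := Real.sqrt_le_one.2 hP.zeta_mem.2.le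

theorem one_le_lamc_mul_rhoEps (hP : P.Admissible) : 1 ≤ P.lamc * P.rhoEps := by
  have hl := hP.lamc_pos
  have hz := Real.sqrt_pos.2 hP.zeta_mem.1
  have h1 : 2 / (P.lamc * √P.zeta) ≤ P.rhoEps := le_max_left _ _
  rw [div_le_iff₀ (by positivity)] at h1
  have hr : 0 < P.lamc * P.rhoEps := by
    by_contra! h
    nlinarith
  nlinarith [hP.sqrt_zeta_le_one]

theorem rhoEps_pos (hP : P.Admissible) : 0 < P.rhoEps := by
  have hl := hP.lamc_pos
  by_contra! h
  nlinarith [hP.one_le_lamc_mul_rhoEps]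

theorem one_le_gap_mul_rhoEps (hP : P.Admissible) : 1 ≤ (1 - |1 - P.lamd|) * P.rhoEps := by
  have hc := hP.lamd_mul_pos
  have hz := Real.sqrt_pos.2 hP.zeta_mem.1
  have hr := hP.rhoEps_pos
  have h1 : √(2 * P.lamd * (2 - P.lamd) + 16) / (P.lamd * (2 - P.lamd) * √P.zeta) ≤ P.rhoEps :=
    le_max_right _ _
  have h2 : √(2 * P.lamd * (2 - P.lamd) + 16) / (P.lamd * (2 - P.lamd)) ≤
      √(2 * P.lamd * (2 - P.lamd) + 16) / (P.lamd * (2 - P.lamd) * √P.zeta) := by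
    exact div_le_div_of_nonneg_left (Real.sqrt_nonneg _) (by positivity)
      (mul_le_of_le_one_right hc.le hP.sqrt_zeta_le_one)
  have h3 := (hP.four_div_le.trans h2).trans h1
  rw [div_le_iff₀ hc] at h3
  nlinarith [mul_le_mul_of_nonneg_right (one_sub_abs_one_sub_ge hP.lamd_mem) hr.le]

theorem contraction_constant_le (hP : P.Admissible) (hσ : P.sigma < 1) :
    3 * P.kappa0 * (P.Delta + 1) ≤ (1 - Real.exp (-P.lam0 * (P.Delta + 1))) * (√2 * P.rho) := by
  have hl := hP.lam0_pos hσ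
  have hd := hP.Delta_pos
  have hk := hP.one_le_kappa0 hσ
  set x := P.lam0 * (P.Delta + 1) with hx
  have hx0 : 0 < x := by positivity
  have h1 : 3 * (P.kappa0 ^ 2 / P.lam0) ≤ √2 * P.rho := by
    linarith [hP.kappa0_sq_div_le hσ, hP.three_mul_le_rho hσ]
  have h2 : x ≤ (1 - Real.exp (-x)) * P.kappa0 := by
    have h3 : Real.exp (-x) * P.kappa0 = 1 := by
      rw [hP.kappa0_eq hσ, ← Real.exp_add]
      simp [hx]
    have h4 := Real.add_one_le_exp x
    rw [hP.kappa0_eq hσ] at *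
    linarith
  have h0 : 0 ≤ 1 - Real.exp (-x) := by
    have := Real.exp_le_one_iff.2 (neg_nonpos.2 hx0.le)
    linarith
  rw [neg_mul, ← hx]
  calc 3 * P.kappa0 * (P.Delta + 1) = x * (3 * (P.kappa0 / P.lam0)) := by
        rw [hx]
        field_simp
    _ ≤ (1 - Real.exp (-x)) * P.kappa0 * (3 * (P.kappa0 / P.lam0)) := by gcongr
    _ = (1 - Real.exp (-x)) * (3 * (P.kappa0 ^ 2 / P.lam0)) := by ring
    _ ≤ _ := by gcongr

theorem Delta_le_rho (hP : P.Admissible) (hσ : P.sigma < 1) : P.Delta ≤ √2 * P.rho := by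
  have h1 := hP.contraction_constant_le hσ
  have hd := hP.Delta_pos
  have hk := hP.one_le_kappa0 hσ
  have hr := hP.rho_pos hσ
  have h2 : (1 - Real.exp (-P.lam0 * (P.Delta + 1))) * (√2 * P.rho) ≤ 1 * (√2 * P.rho) := by
    gcongr
    linarith [Real.exp_pos (-P.lam0 * (P.Delta + 1))]
  nlinarith

end Admissible

end EstParams

/-! ### The error dynamics along a solution -/

namespace EstData

variable {n p m : ℕ} {W : EstData n p m} {P : EstParams} {S : Set (ℝ × ℕ)}
  {ξ : ℝ → ℕ → EstState n p}

theorem eps_flowMap (t : ℝ) (j : ℕ) :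
    W.eps (W.flowMap P (ξ t j)) = -P.lamc • W.eps (ξ t j) + W.alphac P ξ t j := by
  simp only [eps, flowMap, alphac, nuAt, uAt, EstState.x_mk, EstState.eta_mk, EstState.psi_mk,
    add_mulE, smul_mulE]
  module

theorem eps_jumpMap (t : ℝ) (j : ℕ) :
    W.eps (W.jumpMap P (ξ t j)) = (1 - P.lamd) • W.eps (ξ t j) + W.alphad P ξ t j := by
  simp only [eps, jumpMap, alphad, nuAt, uAt, EstState.x_mk, EstState.eta_mk, EstState.psi_mk,
    add_mulE, smul_mulE]
  module

theorem th_flowMap (t : ℝ) (j : ℕ) :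
    -(W.flowMap P (ξ t j)).th = -(P.gamc • mulE (ξ t j).psiᵀ
      (mulE (ξ t j).psi (W.theta - (ξ t j).th))) + W.dc P ξ t j := by
  simp only [flowMap, dc, EstState.th_mk, nuAt]
  rw [← neg_add, ← smul_add, ← mulE_add]
  congr 3
  simp only [eps, mulE_sub]
  abel

theorem psiL_flowMap (ζ : EstState n p) :
    EstState.psiL (W.flowMap P ζ) = -P.lamc • EstState.psiL ζ
      + WithLp.toLp 2 fun q => W.phic ζ.tau ζ.k q.1 q.2 := rfl

theorem psiL_jumpMap (ζ : EstState n p) :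
    EstState.psiL (W.jumpMap P ζ) = (1 - P.lamd) • EstState.psiL ζ
      + WithLp.toLp 2 fun q => W.phid ζ.tau ζ.k q.1 q.2 := rfl

section solution

theorem isHybridArc (hξ : (W.noisySystem P).IsSolution S ξ) : IsHybridArc S ξ := hξ.abs_cont

theorem isHybridArc_clm (hξ : (W.noisySystem P).IsSolution S ξ)
    {V : Type*} [NormedAddCommGroup V] [NormedSpace ℝ V]
    (L : EstState n p →L[ℝ] V) : IsHybridArc S fun s k => L (ξ s k) :=
  (isHybridArc hξ).comp_lipschitz L.lipschitz

theorem ae_hasDerivAt_clm (hξ : (W.noisySystem P).IsSolution S ξ)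
    {V : Type*} [NormedAddCommGroup V] [NormedSpace ℝ V]
    (L : EstState n p →L[ℝ] V) (k : ℕ) :
    ∀ᵐ s, s ∈ interior (timeSlice S k) →
      HasDerivAt (fun r => L (ξ r k)) (L (W.flowMap P (ξ s k))) s := by
  filter_upwards [hξ.flow k] with s hs hmem
  exact L.hasFDerivAt.comp_hasDerivAt s (hs hmem)

theorem mem_stateSet (hξ : (W.noisySystem P).IsSolution S ξ)
    {t : ℝ} {j : ℕ} (h : (t, j) ∈ S) : ξ t j ∈ W.stateSet :=
  hξ.mem_state t j h

theorem eq_jumpMap (hξ : (W.noisySystem P).IsSolution S ξ)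
    {t : ℝ} {j : ℕ} (h : (t, j) ∈ jumpPoints S) :
    ξ t (j + 1) = W.jumpMap P (ξ t j) := hξ.jump t j h

theorem nuAt_succ (hξ : (W.noisySystem P).IsSolution S ξ)
    {t : ℝ} {j : ℕ} (h : (t, j) ∈ jumpPoints S) :
    W.nuAt ξ t (j + 1) = W.nu (ξ t j).tau ((ξ t j).k + 1) := by
  have h1 : ((ξ t j).kReal + 1) = (((ξ t j).k + 1 : ℕ) : ℝ) := by
    rw [(mem_stateSet hξ h.1).1]
    push_cast
    ring
  rw [nuAt, eq_jumpMap hξ h]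
  simp only [jumpMap, EstState.tau_mk, EstState.k_mk]
  rw [h1, Nat.floor_natCast]

theorem th_succ (hξ : (W.noisySystem P).IsSolution S ξ)
    {t : ℝ} {j : ℕ} (h : (t, j) ∈ jumpPoints S) :
    W.theta - (ξ t (j + 1)).th = (W.theta - (ξ t j).th)
      - (1 / (P.gamd + specNorm (ξ t (j + 1)).psi ^ 2)) •
        mulE (ξ t (j + 1)).psiᵀ (mulE (ξ t (j + 1)).psi (W.theta - (ξ t j).th))
      + W.dd P ξ t j := by
  have h1 : (ξ t (j + 1)).th = (ξ t j).th + (1 / (P.gamd + specNorm (ξ t (j + 1)).psi ^ 2)) •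
      mulE (ξ t (j + 1)).psiᵀ ((ξ t (j + 1)).x + W.nuAt ξ t (j + 1) + (ξ t (j + 1)).eta
        - mulE (ξ t (j + 1)).psi (ξ t j).th) := by
    rw [nuAt_succ hξ h, eq_jumpMap hξ h]
    rfl
  have h2 : (ξ t (j + 1)).x + W.nuAt ξ t (j + 1) + (ξ t (j + 1)).eta
        - mulE (ξ t (j + 1)).psi (ξ t j).th
      = mulE (ξ t (j + 1)).psi (W.theta - (ξ t j).th)
        + (W.eps (ξ t (j + 1)) + W.nuAt ξ t (j + 1)) := by
    rw [eps, mulE_sub]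
    abel
  rw [h1, h2, mulE_add, smul_add, dd]
  abel

theorem frobNorm_psi_le (hξ : (W.noisySystem P).IsSolution S ξ) (hP : P.Admissible)
    (hphic : ∀ t j, (t, j) ∈ W.E → frobNorm (W.phic t j) ≤ P.phiM)
    (hphid : ∀ t j, (t, j) ∈ jumpPoints W.E → frobNorm (W.phid t j) ≤ P.phiM)
    (hξ0 : ξ 0 0 ∈ W.initialSet P) {t : ℝ} {j : ℕ} (h : (t, j) ∈ S) :
    frobNorm (ξ t j).psi ≤ P.psiM := by
  have hlc := hP.lamc_pos
  have hc := hP.lamd_mul_pos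
  have hφ := hP.phiM_pos
  set R := max (1 / P.lamc) (√(2 * P.lamd * (2 - P.lamd) + 16) / (P.lamd * (2 - P.lamd)))
    with hR
  have hR1 : 1 / P.lamc ≤ R := le_max_left _ _
  have hR2 : 4 / (P.lamd * (2 - P.lamd)) ≤ R := hP.four_div_le.trans (le_max_right _ _)
  have hR0 : 0 < R := lt_of_lt_of_le (by positivity) hR1
  rw [div_le_iff₀ hlc] at hR1
  rw [div_le_iff₀ hc] at hR2
  have hgap : 1 ≤ (1 - |1 - P.lamd|) * R := by
    nlinarith [mul_le_mul_of_nonneg_right (one_sub_abs_one_sub_ge hP.lamd_mem) hR0.le]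
  have hgap' : |1 - P.lamd| ≤ Real.exp (-0) := by
    have := one_sub_abs_one_sub_ge hP.lamd_mem
    simp only [neg_zero, Real.exp_zero]
    linarith
  have key := (isHybridArc_clm hξ EstState.psiL).norm_le_of_filter hξ.dom h (l := 0)
    (D := P.phiM) (R := R * P.phiM) hlc hlc.le hgap' hφ.le (by nlinarith) (by nlinarith)
    (fun k _ => ?_) fun k s _ _ hj => ?_
  · simp only [neg_zero, zero_mul, Real.exp_zero, one_mul, EstState.norm_psiL] at key
    refine key.trans ?_
    rw [EstParams.psiM, ← hR]
    linarith [hξ0.2]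
  · filter_upwards [ae_hasDerivAt_clm hξ EstState.psiL k] with s hs hmem _
    have hst := mem_stateSet hξ (mem_of_mem_interior_timeSlice hmem)
    refine ⟨_, ?_, psiL_flowMap (P := P) (ξ s k) ▸ hs hmem⟩
    rw [← frobNorm_eq]
    exact hphic _ _ hst.2
  · have hD := hξ.jump_mem s k hj
    refine ⟨_, ?_, (congrArg EstState.psiL (eq_jumpMap hξ hj)).trans (psiL_jumpMap (ξ s k))⟩
    rw [← frobNorm_eq]
    exact hphid _ _ ⟨hD.1.2, hD.2⟩

theorem norm_eps_le (hξ : (W.noisySystem P).IsSolution S ξ)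
    (hP : P.Admissible) {t : ℝ} {j : ℕ} (h : (t, j) ∈ S)
    (hfin : hybridSupNorm S (W.dEps P S ξ) t j ≠ ∞) :
    ‖W.eps (ξ t j)‖ ≤ Real.exp (-P.lamEps * (t + j)) * ‖W.eps (ξ 0 0)‖
      + P.rhoEps * (hybridSupNorm S (W.dEps P S ξ) t j).toReal := by
  set D := (hybridSupNorm S (W.dEps P S ξ) t j).toReal with hD
  have hD0 : 0 ≤ D := ENNReal.toReal_nonneg
  refine (isHybridArc_clm hξ W.epsL).norm_le_of_filter hξ.dom h (D := D) hP.lamc_pos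
    hP.lamEps_le_lamc hP.abs_one_sub_lamd_le hD0 ?_ ?_ (fun k hk => ?_) fun k s hk hs hj => ?_
  · nlinarith [mul_le_mul_of_nonneg_right hP.one_le_lamc_mul_rhoEps hD0]
  · nlinarith [mul_le_mul_of_nonneg_right hP.one_le_gap_mul_rhoEps hD0]
  · filter_upwards [ae_hasDerivAt_clm hξ W.epsL k, ae_norm_le_hybridSupNorm hξ.dom hfin hk]
      with s hs hn hmem hst
    obtain ⟨h1, h2⟩ := hn (mem_of_mem_interior_timeSlice hmem) hst
    rw [dEps, if_neg h1] at h2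
    exact ⟨_, h2, eps_flowMap (W := W) (P := P) (ξ := ξ) s k ▸ hs hmem⟩
  · have h2 := norm_le_hybridSupNorm_of_jump hfin hj hs hk.le
    rw [dEps, if_pos hj] at h2
    exact ⟨_, h2, (congrArg W.eps (eq_jumpMap hξ hj)).trans (eps_jumpMap s k)⟩

theorem continuousOn_psi (hξ : (W.noisySystem P).IsSolution S ξ)
    {k : ℕ} {c d : ℝ} (h : Icc c d ⊆ timeSlice S k) :
    ContinuousOn (fun s => (ξ s k).psi) (Icc c d) := by
  have h1 := (isHybridArc hξ).continuousOn h
  refine continuousOn_pi.2 fun i => continuousOn_pi.2 fun a => ?_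
  have h2 : Continuous fun ζ : EstState n p => ζ.psi i a := by
    unfold EstState.psi
    simp only [Matrix.of_apply]
    fun_prop
  exact h2.comp_continuousOn h1

theorem isPerturbedGradientArc (hξ : (W.noisySystem P).IsSolution S ξ) (hP : P.Admissible)
    (hψ : ∀ s k, (s, k) ∈ S → frobNorm (ξ s k).psi ≤ P.psiM) {t : ℝ} {j : ℕ}
    (hfin : hybridSupNorm S (W.dTot P S ξ) t j ≠ ∞) :
    IsPerturbedGradientArc S (fun s k => W.theta - (ξ s k).th) (fun s k => (ξ s k).psi)
      P.gamc P.gamd P.psiM (hybridSupNorm S (W.dTot P S ξ) t j).toReal (t, j) where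
  dom := hξ.dom
  arc := by
    refine (isHybridArc_clm hξ EstState.thL).comp_lipschitz (L := fun y => W.theta - y) (K := 1) ?_
    exact LipschitzWith.of_dist_le_mul fun x y => by
      rw [dist_sub_left, NNReal.coe_one, one_mul]
  continuousOn k c d hsub := continuousOn_psi hξ hsub
  γc_pos := hP.gamc_pos
  γd_pos := hP.gamd_pos
  D_nonneg := ENNReal.toReal_nonneg
  bound s k hs _ _ := (specNorm_le_frobNorm _).trans (hψ s k hs)
  flow k hk := by
    filter_upwards [ae_hasDerivAt_clm hξ EstState.thL k, ae_norm_le_hybridSupNorm hξ.dom hfin hk]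
      with s hs hn hmem hst
    obtain ⟨h1, h2⟩ := hn (mem_of_mem_interior_timeSlice hmem) hst
    rw [dTot, if_neg h1] at h2
    exact ⟨_, h2, th_flowMap (W := W) (P := P) (ξ := ξ) s k ▸ (hs hmem).const_sub W.theta⟩
  jump k s hk hs hj := by
    have h2 := norm_le_hybridSupNorm_of_jump hfin hj hs hk.le
    rw [dTot, if_pos hj] at h2
    exact ⟨_, h2, th_succ hξ hj⟩

theorem sigma_lt_one (hξ : (W.noisySystem P).IsSolution S ξ) (hP : P.Admissible)
    (hψ : ∀ s k, (s, k) ∈ S → frobNorm (ξ s k).psi ≤ P.psiM)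
    (hPE : HybridPE S (fun t j => (ξ t j).psi) P.Delta P.mu)
    (hvoid : (p = 0 ∨ ∀ a ∈ S, ∀ b ∈ S, ¬ IsWindow P.Delta a b) → P.sigma < 1) :
    P.sigma < 1 := by
  by_cases hv : p = 0 ∨ ∀ a ∈ S, ∀ b ∈ S, ¬ IsWindow P.Delta a b
  · exact hvoid hv
  push Not at hv
  obtain ⟨hp, a, ha, c, hc, hw⟩ := hv
  have ha1 : 0 ≤ a.1 := hξ.dom.fst_nonneg (k := a.2) ha
  have ha2 : (0 : ℝ) ≤ a.2 := Nat.cast_nonneg _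
  obtain ⟨e, he, hec, h1, h2⟩ := hξ.dom.exists_mem_level hc (c := c.1 + c.2 - P.Delta)
    (by linarith [hw.1]) (by linarith [hP.Delta_pos])
  have hexc := hPE e he c hc ⟨by linarith, by linarith⟩
  refine hP.sigma_lt_one_of_mu_le ?_
  refine (le_of_excitation_posSemidef hξ.dom (fun k s t => continuousOn_psi hξ)
    (fun s k hs => (specNorm_le_frobNorm _).trans (hψ s k hs)) he hc hec hexc
    (Nat.pos_of_ne_zero hp)).trans (mul_le_mul_of_nonneg_left ?_ (sq_nonneg _))
  linarith

/-- The parameter error. -/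
theorem norm_theta_sub_le (hξ : (W.noisySystem P).IsSolution S ξ) (hP : P.Admissible)
    (hψ : ∀ s k, (s, k) ∈ S → frobNorm (ξ s k).psi ≤ P.psiM)
    (hPE : HybridPE S (fun t j => (ξ t j).psi) P.Delta P.mu) (hσ : P.sigma < 1)
    {t : ℝ} {j : ℕ} (h : (t, j) ∈ S) (hfin : hybridSupNorm S (W.dTot P S ξ) t j ≠ ∞) :
    ‖W.theta - (ξ t j).th‖ ≤ P.kappa0 * Real.exp (-P.lam0 * (t + j)) * ‖W.theta - (ξ 0 0).th‖
      + √2 * P.rho * (hybridSupNorm S (W.dTot P S ξ) t j).toReal := by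
  have harc := isPerturbedGradientArc hξ hP hψ hfin
  have hd := hP.Delta_pos
  have hs : P.sigma = 2 * (min P.gamc (1 / (2 * (P.gamd + P.psiM ^ 2))) * P.mu)
      / (1 + P.rootK) ^ 2 := rfl
  have hK1 : 2 * (P.Delta + 1) * (P.gamc * P.psiM ^ 2 + 1 / 2) ≤ P.rootK ^ 2 := hP.rootK_sq_ge
  have hK2 : (P.Delta + 1) ^ 2 * (P.gamc * P.psiM ^ 2 + 1 / 2) * (P.gamc * P.psiM ^ 2 + 2) ≤
      P.rootK ^ 2 := hP.rootK_sq_ge'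
  have hwin : ∀ a ∈ S, ∀ c ∈ S, a ≤ c → c ≤ (t, j) → IsWindow P.Delta a c →
      ‖W.theta - (ξ c.1 c.2).th‖ ≤
        Real.exp (-P.lam0 * (P.Delta + 1)) * ‖W.theta - (ξ a.1 a.2).th‖
        + 3 * P.kappa0 * (P.Delta + 1) * (hybridSupNorm S (W.dTot P S ξ) t j).toReal := by
    intro a ha c hc hac hcb hw
    have hcon := harc.contraction ha hc hac hcb hw.2.le (by linarith) hP.mu_pos.le
      P.rootK_nonneg hK1 hK2 (hPE a ha c hc hw) (hs ▸ hσ)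
    rw [← hs, hP.sqrt_one_sub_sigma hσ] at hcon
    refine hcon.trans_eq ?_
    rw [hP.kappa0_eq hσ, neg_mul, Real.exp_neg]
    field_simp
  rw [hP.kappa0_eq hσ]
  have key := harc.norm_le_exp (C₀ := 3 * P.kappa0 * (P.Delta + 1)) (C := √2 * P.rho)
    (c := (t, j)) hd (hP.lam0_pos hσ).le hwin (hP.contraction_constant_le hσ)
    (hP.Delta_le_rho hσ) h le_rfl
  simpa only using key

end solution

theorem norm_alphac_le {Lc : ℝ} (hlc : 0 < P.lamc)
    (hfcL : ∀ x₁ x₂ u, ‖W.fc x₁ u - W.fc x₂ u‖ ≤ Lc * ‖x₁ - x₂‖) (t : ℝ) (j : ℕ) :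
    ‖W.alphac P ξ t j‖ ≤ (P.lamc + Lc) * ‖W.nuAt ξ t j‖ := by
  rw [alphac, add_sub_assoc]
  refine (norm_add_le _ _).trans ?_
  have h1 := hfcL (ξ t j).x ((ξ t j).x + W.nuAt ξ t j) (W.uAt ξ t j)
  rw [sub_add_cancel_left, norm_neg] at h1
  rw [norm_smul, norm_neg, Real.norm_of_nonneg hlc.le]
  linarith

theorem norm_alphad_le {Ld : ℝ}
    (hgdL : ∀ x₁ x₂ u, ‖W.gd x₁ u - W.gd x₂ u‖ ≤ Ld * ‖x₁ - x₂‖) (t : ℝ) (j : ℕ) :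
    ‖W.alphad P ξ t j‖ ≤ (|1 - P.lamd| + Ld) * ‖W.nuAt ξ t j‖ := by
  rw [alphad, add_sub_assoc]
  refine (norm_add_le _ _).trans ?_
  have h1 := hgdL (ξ t j).x ((ξ t j).x + W.nuAt ξ t j) (W.uAt ξ t j)
  rw [sub_add_cancel_left, norm_neg] at h1
  rw [norm_smul, Real.norm_eq_abs]
  linarith

end EstData

/-! ### The main estimate -/

theorem sqrt_add_sq_le (a b c d : ℝ) :
    √((a + c) ^ 2 + (b + d) ^ 2) ≤ √(a ^ 2 + b ^ 2) + √(c ^ 2 + d ^ 2) := by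
  refine Real.sqrt_le_iff.2 ⟨by positivity, ?_⟩
  have h1 := Real.sq_sqrt (by positivity : 0 ≤ a ^ 2 + b ^ 2)
  have h2 := Real.sq_sqrt (by positivity : 0 ≤ c ^ 2 + d ^ 2)
  have h3 : a * c + b * d ≤ √(a ^ 2 + b ^ 2) * √(c ^ 2 + d ^ 2) := by
    rw [← Real.sqrt_mul (by positivity)]
    refine Real.le_sqrt_of_sq_le ?_
    nlinarith [sq_nonneg (a * d - b * c)]
  nlinarith

theorem sqrt_add_div_le {z e z₀ e₀ k r A B w : ℝ} (hz : 0 ≤ z) (he : 0 ≤ e) (hk : 0 ≤ k)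
    (hr : 0 ≤ r) (hw : 1 ≤ w) (h1 : z ≤ k * z₀ + r * A) (h2 : e ≤ k * e₀ + r * B) :
    √(z ^ 2 + e ^ 2 / w) ≤ k * √(z₀ ^ 2 + e₀ ^ 2 / w) + r * √(A ^ 2 + B ^ 2) := by
  have hw0 : 0 < w := by linarith
  have hs := Real.sqrt_pos.2 hw0
  have hsw := Real.sq_sqrt hw0.le
  have e1 : ∀ y : ℝ, y ^ 2 / w = (y / √w) ^ 2 := fun y => by rw [div_pow, hsw]
  have h3 : e / √w ≤ k * (e₀ / √w) + r * (B / √w) := by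
    rw [← mul_div_assoc, ← mul_div_assoc, ← add_div]
    gcongr
  have e2 : ∀ {c x y : ℝ}, 0 ≤ c → √((c * x) ^ 2 + (c * y) ^ 2) = c * √(x ^ 2 + y ^ 2) := by
    intro c x y hc
    rw [mul_pow, mul_pow, ← mul_add, Real.sqrt_mul (sq_nonneg c), Real.sqrt_sq hc]
  rw [e1, e1]
  calc √(z ^ 2 + (e / √w) ^ 2)
      ≤ √((k * z₀ + r * A) ^ 2 + (k * (e₀ / √w) + r * (B / √w)) ^ 2) := by gcongr
    _ ≤ _ := sqrt_add_sq_le _ _ _ _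
    _ = k * √(z₀ ^ 2 + (e₀ / √w) ^ 2) + r * √(A ^ 2 + (B / √w) ^ 2) := by rw [e2 hk, e2 hr]
    _ ≤ _ := by
      rw [← e1 B]
      gcongr
      exact div_le_self (sq_nonneg B) hw

namespace EstData

variable {n p m : ℕ} {W : EstData n p m} {P : EstParams} {S : Set (ℝ × ℕ)}
  {ξ : ℝ → ℕ → EstState n p}

theorem dNu_eq_ofReal {t : ℝ} {j : ℕ} (hd : hybridSupNorm S (W.dTot P S ξ) t j ≠ ∞)
    (he : hybridSupNorm S (W.dEps P S ξ) t j ≠ ∞) :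
    W.dNu P S ξ t j = ENNReal.ofReal √((hybridSupNorm S (W.dTot P S ξ) t j).toReal ^ 2
      + (hybridSupNorm S (W.dEps P S ξ) t j).toReal ^ 2) := by
  rw [dNu, Real.sqrt_eq_rpow, ← ENNReal.ofReal_rpow_of_nonneg (by positivity) (by norm_num),
    ENNReal.ofReal_add (by positivity) (by positivity),
    ENNReal.ofReal_pow ENNReal.toReal_nonneg, ENNReal.ofReal_pow ENNReal.toReal_nonneg,
    ENNReal.ofReal_toReal hd, ENNReal.ofReal_toReal he]

theorem dNu_eq_top {t : ℝ} {j : ℕ} (h : hybridSupNorm S (W.dTot P S ξ) t j = ∞ ∨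
    hybridSupNorm S (W.dEps P S ξ) t j = ∞) : W.dNu P S ξ t j = ∞ := by
  rw [dNu, ENNReal.rpow_eq_top_iff_of_pos (by norm_num)]
  rcases h with h | h <;> simp [h]

section solution

theorem infDist_le (hξ : (W.noisySystem P).IsSolution S ξ) (hP : P.Admissible)
    (hψ : ∀ s k, (s, k) ∈ S → frobNorm (ξ s k).psi ≤ P.psiM)
    (hPE : HybridPE S (fun t j => (ξ t j).psi) P.Delta P.mu) (hσ : P.sigma < 1)
    {t : ℝ} {j : ℕ} (h : (t, j) ∈ S) :
    ENNReal.ofReal (Metric.infDist (ξ t j) W.target) ≤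
      ENNReal.ofReal (P.kappaNu * Real.exp (-P.lamNu * (t + j)) *
          Metric.infDist (ξ 0 0) W.target)
        + ENNReal.ofReal P.rhoNu * W.dNu P S ξ t j := by
  have hρ := hP.rhoNu_pos hσ
  by_cases hinf : hybridSupNorm S (W.dTot P S ξ) t j = ∞ ∨
    hybridSupNorm S (W.dEps P S ξ) t j = ∞
  · rw [dNu_eq_top hinf, ENNReal.mul_top (by simpa using hρ), add_top]
    exact le_top
  push Not at hinf
  obtain ⟨hd, he⟩ := hinf
  have hκ := hP.kappaNu_pos hσ
  have ht : 0 ≤ t := hξ.dom.fst_nonneg h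
  have hT : 0 ≤ t + j := by positivity
  rw [dNu_eq_ofReal hd he, ← ENNReal.ofReal_mul hρ.le,
    ← ENNReal.ofReal_add (mul_nonneg (by positivity) Metric.infDist_nonneg) (by positivity),
    W.infDist_target (mem_stateSet hξ h), W.infDist_target (mem_stateSet hξ hξ.dom.zero_mem)]
  refine ENNReal.ofReal_le_ofReal ?_
  have hz := norm_theta_sub_le hξ hP hψ hPE hσ h hd
  have hε := norm_eps_le hξ hP h he
  set A := (hybridSupNorm S (W.dTot P S ξ) t j).toReal
  set B := (hybridSupNorm S (W.dEps P S ξ) t j).toReal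
  have hA : 0 ≤ A := ENNReal.toReal_nonneg
  have hB : 0 ≤ B := ENNReal.toReal_nonneg
  have hk0 := hP.kappa0_le_kappaNu hσ
  have hk1 := hP.one_le_kappa0 hσ
  have hexp0 : Real.exp (-P.lam0 * (t + j)) ≤ Real.exp (-P.lamNu * (t + j)) := by
    have : P.lamNu ≤ P.lam0 := (min_le_left _ _).trans (hP.omega_le_lam0 hσ)
    gcongr
  have hexp1 : Real.exp (-P.lamEps * (t + j)) ≤ 1 * Real.exp (-P.lamNu * (t + j)) := by
    have : P.lamNu ≤ P.lamEps := min_le_right _ _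
    rw [one_mul]
    gcongr
  have hr0 : √2 * P.rho ≤ P.rhoNu :=
    mul_le_mul_of_nonneg_left (le_max_left _ _) (by positivity)
  have hr1 : P.rhoEps ≤ P.rhoNu := by
    have h1 : √2 * P.rhoEps ≤ P.rhoNu :=
      mul_le_mul_of_nonneg_left (le_max_right _ _) (by positivity)
    have h2 : 1 ≤ √2 := Real.one_le_sqrt.2 one_le_two
    nlinarith [hP.rhoEps_pos]
  refine sqrt_add_div_le (norm_nonneg _) (norm_nonneg _) (by positivity) hρ.le
    (by nlinarith [sq_nonneg ‖W.theta‖]) (hz.trans ?_) (hε.trans ?_)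
  · gcongr
  · refine add_le_add (mul_le_mul_of_nonneg_right (hexp1.trans ?_) (norm_nonneg _))
      (mul_le_mul_of_nonneg_right hr1 hB)
    exact mul_le_mul_of_nonneg_right (hk1.trans hk0) (Real.exp_pos _).le

theorem enorm_eps_le (hξ : (W.noisySystem P).IsSolution S ξ)
    (hP : P.Admissible) {Lc Ld : ℝ} (hLc : 0 < Lc)
    (hfcL : ∀ x₁ x₂ u, ‖W.fc x₁ u - W.fc x₂ u‖ ≤ Lc * ‖x₁ - x₂‖)
    (hgdL : ∀ x₁ x₂ u, ‖W.gd x₁ u - W.gd x₂ u‖ ≤ Ld * ‖x₁ - x₂‖) {t : ℝ} {j : ℕ}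
    (h : (t, j) ∈ S) :
    ‖W.eps (ξ t j)‖ₑ ≤ ENNReal.ofReal (Real.exp (-P.lamEps * (t + j)) * ‖W.eps (ξ 0 0)‖)
      + ENNReal.ofReal (P.rhoEps * max (P.lamc + Lc) (|1 - P.lamd| + Ld)) *
          hybridSupNorm S (W.nuAt ξ) t j := by
  have hlc := hP.lamc_pos
  have hρ := hP.rhoEps_pos
  set L := max (P.lamc + Lc) (|1 - P.lamd| + Ld) with hL
  have hL0 : 0 < L := lt_max_of_lt_left (by positivity)
  have hle : hybridSupNorm S (W.dEps P S ξ) t j ≤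
      ENNReal.ofReal L * hybridSupNorm S (W.nuAt ξ) t j := by
    refine hybridSupNorm_le_const_mul hL0.le fun s k => ?_
    unfold dEps
    split_ifs
    · exact (norm_alphad_le hgdL s k).trans
        (mul_le_mul_of_nonneg_right (le_max_right _ _) (norm_nonneg _))
    · exact (norm_alphac_le hlc hfcL s k).trans
        (mul_le_mul_of_nonneg_right (le_max_left _ _) (norm_nonneg _))
  rw [ENNReal.ofReal_mul hρ.le, mul_assoc]
  refine le_trans ?_ (add_le_add_right (mul_le_mul_right hle _) _)
  by_cases hfin : hybridSupNorm S (W.dEps P S ξ) t j = ∞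
  · rw [hfin, ENNReal.mul_top (by simpa using hρ), add_top]
    exact le_top
  · have := norm_eps_le hξ hP h hfin
    rw [← ofReal_norm]
    refine (ENNReal.ofReal_le_ofReal this).trans_eq ?_
    rw [ENNReal.ofReal_add (by positivity) (by positivity), ENNReal.ofReal_mul hρ.le,
      ENNReal.ofReal_toReal hfin]

end solution

theorem enorm_le_mul_add {V V' : Type*} [NormedAddCommGroup V] [NormedAddCommGroup V'] {a : V}
    {b b' : V'} {c : ℝ} {B : ℝ≥0∞} (hc : 0 ≤ c) (h : ‖a‖ ≤ c * ‖b + b'‖) (hb : ‖b‖ₑ ≤ B) :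
    ‖a‖ₑ ≤ ENNReal.ofReal c * (B + ‖b'‖ₑ) := by
  rw [← ofReal_norm]
  refine (ENNReal.ofReal_le_ofReal h).trans ?_
  rw [ENNReal.ofReal_mul hc, ofReal_norm]
  exact mul_le_mul_right ((enorm_add_le _ _).trans (add_le_add_left hb _)) _

theorem norm_dc_le (hγ : 0 ≤ P.gamc) {t : ℝ} {j : ℕ} (hψ : frobNorm (ξ t j).psi ≤ P.psiM) :
    ‖W.dc P ξ t j‖ ≤ P.gamc * P.psiM * ‖W.eps (ξ t j) + W.nuAt ξ t j‖ := by
  rw [dc, norm_neg, norm_smul, Real.norm_of_nonneg hγ, mul_assoc]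
  exact mul_le_mul_of_nonneg_left ((norm_mulE_transpose_le _ _).trans
    (mul_le_mul_of_nonneg_right ((specNorm_le_frobNorm _).trans hψ) (norm_nonneg _))) hγ

theorem norm_dd_le (hγ : 0 < P.gamd) (t : ℝ) (j : ℕ) :
    ‖W.dd P ξ t j‖ ≤ 1 / (2 * √P.gamd) * ‖W.eps (ξ t (j + 1)) + W.nuAt ξ t (j + 1)‖ := by
  rw [dd, norm_neg, norm_smul, Real.norm_of_nonneg (by positivity)]
  refine (mul_le_mul_of_nonneg_left (norm_mulE_transpose_le _ _) (by positivity)).trans ?_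
  rw [← mul_assoc]
  exact mul_le_mul_of_nonneg_right (specNorm_div_le _ hγ) (norm_nonneg _)

end EstData

theorem mainTheorem4 {n p m : ℕ} (W : EstData n p m) (P : EstParams) (hP : P.Admissible)
    (hE : IsHybridTimeDomain W.E)
    (hfc : Continuous fun z : EuclideanSpace ℝ (Fin n) × EuclideanSpace ℝ (Fin m) => W.fc z.1 z.2)
    (hgd : Continuous fun z : EuclideanSpace ℝ (Fin n) × EuclideanSpace ℝ (Fin m) => W.gd z.1 z.2)
    (Lc Ld : ℝ) (hLc : 0 < Lc) (hLd : 0 < Ld)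
    (hfcL : ∀ x₁ x₂ u, ‖W.fc x₁ u - W.fc x₂ u‖ ≤ Lc * ‖x₁ - x₂‖)
    (hgdL : ∀ x₁ x₂ u, ‖W.gd x₁ u - W.gd x₂ u‖ ≤ Ld * ‖x₁ - x₂‖)
    (hphic : ∀ t j, (t, j) ∈ W.E → frobNorm (W.phic t j) ≤ P.phiM)
    (hphid : ∀ t j, (t, j) ∈ jumpPoints W.E → frobNorm (W.phid t j) ≤ P.phiM)
    (S : Set (ℝ × ℕ)) (ξ : ℝ → ℕ → EstState n p)
    (hξ : (W.noisySystem P).IsSolution S ξ) (hξ0 : ξ 0 0 ∈ W.initialSet P)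
    (hPE : HybridPE S (fun t j => (ξ t j).psi) P.Delta P.mu)
    -- only if the excitation condition is void (no parameters or no window in the domain):
    -- `μ` is small enough for the constants `κ₀`, `λ₀` to be defined
    (hvoid : (p = 0 ∨ ∀ a ∈ S, ∀ b ∈ S, ¬ IsWindow P.Delta a b) → P.sigma < 1) :
    (0 < P.kappaNu ∧ 0 < P.lamNu ∧ 0 < P.rhoNu) ∧
    (∀ t j, (t, j) ∈ S →
      ENNReal.ofReal (Metric.infDist (ξ t j) W.target) ≤
        ENNReal.ofReal (P.kappaNu * Real.exp (-P.lamNu * (t + j)) *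
            Metric.infDist (ξ 0 0) W.target)
          + ENNReal.ofReal P.rhoNu * W.dNu P S ξ t j) ∧
    (∀ t j, (t, j) ∈ S →
      ‖W.dc P ξ t j‖ₑ ≤ ENNReal.ofReal (P.gamc * P.psiM) *
        (ENNReal.ofReal (Real.exp (-P.lamEps * (t + j)) * ‖W.eps (ξ 0 0)‖)
          + ENNReal.ofReal (P.rhoEps * max (P.lamc + Lc) (|1 - P.lamd| + Ld)) *
              hybridSupNorm S (W.nuAt ξ) t j
          + ‖W.nuAt ξ t j‖ₑ)) ∧
    (∀ t j, (t, j) ∈ S → ‖W.alphac P ξ t j‖ ≤ (P.lamc + Lc) * ‖W.nuAt ξ t j‖) ∧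
    (∀ t j, (t, j) ∈ jumpPoints S →
      ‖W.dd P ξ t j‖ₑ ≤ ENNReal.ofReal (1 / (2 * √P.gamd)) *
        (ENNReal.ofReal (Real.exp (-P.lamEps * (t + j + 1)) * ‖W.eps (ξ 0 0)‖)
          + ENNReal.ofReal (P.rhoEps * max (P.lamc + Lc) (|1 - P.lamd| + Ld)) *
              hybridSupNorm S (W.nuAt ξ) t (j + 1)
          + ‖W.nuAt ξ t (j + 1)‖ₑ)) ∧
    (∀ t j, (t, j) ∈ jumpPoints S →
      ‖W.alphad P ξ t j‖ ≤ (|1 - P.lamd| + Ld) * ‖W.nuAt ξ t j‖) := by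
  have hψ : ∀ s k, (s, k) ∈ S → frobNorm (ξ s k).psi ≤ P.psiM := fun s k hs =>
    EstData.frobNorm_psi_le hξ hP hphic hphid hξ0 hs
  have hσ := EstData.sigma_lt_one hξ hP hψ hPE hvoid
  have hψM := hP.psiM_pos
  have hγc := hP.gamc_pos
  refine ⟨⟨hP.kappaNu_pos hσ, hP.lamNu_pos hσ, hP.rhoNu_pos hσ⟩,
    fun t j h => EstData.infDist_le hξ hP hψ hPE hσ h, fun t j h => ?_,
    fun t j _ => EstData.norm_alphac_le hP.lamc_pos hfcL t j, fun t j h => ?_,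
    fun t j _ => EstData.norm_alphad_le hgdL t j⟩
  · exact EstData.enorm_le_mul_add (by positivity) (EstData.norm_dc_le hγc.le (hψ t j h))
      (EstData.enorm_eps_le hξ hP hLc hfcL hgdL h)
  · have hε := EstData.enorm_eps_le hξ hP hLc hfcL hgdL h.2
    push_cast at hε
    rw [← add_assoc] at hε
    exact EstData.enorm_le_mul_add (by positivity) (EstData.norm_dd_le hP.gamd_pos t j) hε
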